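/- **Setting.** Let $F$ be a finite field, $1\le k\le n$ and $m\ge 0$ integers, and $x_0,\dots,x_n\in F$ distinct points. Alice and Bob are honest users, $P_1,\dots,P_n$ are Security Hubs. For an honest hub $P_i$, Alice and $P_i$ share a uniformly random table segment $(R_i,v_i)\in F^{3+m}\times F^2$, and Bob and $P_i$ share a uniformly random segment $(\bar R_i,\bar v_i)\in F^{3+m}\times F^2$, all independent and used once. All other communication (Alice to $P_i$, $P_i$ to Bob) is over completely insecure channels. Put $$h_{c,d}(y_1,\dots,y_s)=d+\sum_{j=1}^{s}c^jy_j,\qquad h'_{c,d,e}(y_1,\dots,y_m)=d+ce+\sum_{j=1}^{m}c^{j+1}y_j .$$ **One execution of the DSKE protocol.** Alice takes, in each of the $3+m$ coordinates, the polynomial of degree less than $k$ whose value at $x_i$ is the corresponding coordinate of $R_i$ for $i=1,\dots,k$. Let $Y_i\in F^{3+m}$ be the vector of values at $x_i$ ($0\le i\le n$), write $Y_0=u\,\|\,S$ with $u\in F^3$ and $S\in F^m$, and let $o=h'_u(S)$ be the secret-authenticating tag. For each $i$ she sends $P_i$ the message $M_i=A\|B\|K\|g(j_i)\|Z_i\|o$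 with $Z_i=Y_i-R_i$ and the tag $h_{v_i}(M_i)$; here $A,B$ are the user identifiers, $K$ is a key identifier and $g(j_i)\in F$ encodes the table offset (here the only one). A hub takes the first message received whose identifiers $A,B$ and offset are the expected ones (this uses up its segment), checks the message tag, and on success computes $Y_i=Z_i+R_i$ and sends Bob $\bar M_i=A\|B\|K\|g(\bar j_i)\|(Y_i-\bar R_i)\|o$ with the tag $h_{\bar v_i}(\bar M_i)$. Bob treats the messages arriving in the name of each $P_i$ in the same way and obtains shares $Y_i$. From every set of $k$ accepted messages with common $(K,o)$ he reconstructs a candidate $Y_0=u\|S$ by interpolation at $x_0$, and keeps it if $o=h'_u(S)$. When asked to finish, he outputs $(K,S)$ of some remaining candidate (by an arbitrary fixed rule), or aborts ($\bot$) if there is none. Let $s$ be the number of field elements of an authenticated message $M_i$. **Adversary.** Eve is computationally unbounded. She sees all messages, decides adaptively which messages are delivered to the hubs and to Bob and in which order (she may drop, alter, reorder and inject), and schedules the honest hubs. In addition she fully controls an arbitrary fixed set $C$ of compromised hubs, including the tables that these give to Alice and Bob. The shared segments of the honest hubs are not accessible to her. **Security.** The ideal resource holds a uniformly random $S\in F^m$.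 It outputs $(K,S)$ to Alice on request; it tells Eve only whether Alice has started; and when Bob asks it outputs to him, once and for all, $(K,S)$ if Alice has started and a switch set by Eve is on, and $\bot$ otherwise. The protocol is *$\delta$-secure* (in the sense of constructive cryptography) if for every set $C$ of fewer than $k$ compromised hubs there is a simulator (a converter attached to Eve's interface of the ideal resource) such that the distinguishing advantage of every computationally unbounded distinguisher, which interacts adaptively with all interfaces (Alice's, Bob's and Eve's) and makes finitely many queries, between the real system and the ideal resource with the simulator is at most $\delta$. This covers both correctness (Bob's secret equals Alice's unless he aborts) and confidentiality. **Theorem 1 (Security of the DSKE protocol).** The DSKE protocol using an $(n,k)$-threshold Shamir scheme over $F$ is $(\varepsilon+2n\varepsilon')$-secure, where $$\varepsilon=\min\!\Big(\binom nk\frac{m+1}{|F|},\,1\Big),\qquad \varepsilon'=\min\!\Big(\frac{s}{|F|},\,1\Big).$$ -/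

import Mathlib

/-! ## Constructive cryptography: interfaces, resources, converters, distinguishers -/

namespace CC

/-- An interface of a system: the queries it accepts and, for each query, the type of answers. -/
structure Interface where
  Q : Type
  R : Q → Type

/-- The joint interface of a family of interfaces: a query is addressed to one of them and is
answered there. -/
def Interface.joint {ι : Type} (I : ι → Interface) : Interface where
  Q := Σ i, (I i).Q
  R q := (I q.1).R q.2

/-- Probabilistic interactive computations, of unbounded computing power, that make adaptive
queries to the interface `I`, finitely many on every branch, and return an element of `α`. -/
inductive Prog (I : Interface) (α : Type) : Type 1
  | ret (a : α) : Prog I α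
  | query (q : I.Q) (next : I.R q → Prog I α) : Prog I α
  | sample (Ω : Type) (p : PMF Ω) (next : Ω → Prog I α) : Prog I α

/-- Run a computation against a stateful system; the result and the new state are returned. -/
noncomputable def Prog.run {I : Interface} {α St : Type}
    (step : St → (q : I.Q) → PMF (I.R q × St)) : Prog I α → St → PMF (α × St)
  | .ret a, s => PMF.pure (a, s)
  | .query q next, s => (step s q).bind fun r => (next r.1).run step r.2
  | .sample _ p next, s => p.bind fun w => (next w).run step s

/-- A resource: a probabilistic reactive system. -/
structure Resource (I : Interface) where
  State : Type
  start : PMF State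
  step : State → (q : I.Q) → PMF (I.R q × State)

/-- A converter: attached to the interface `inner` of a resource, it offers `outer` instead.
It may keep a state, and it may sample and query `inner` whenever it is queried. -/
structure Converter (outer inner : Interface) where
  State : Type
  start : State
  step : State → (q : outer.Q) → Prog inner (outer.R q × State)

/-- The converter that only forwards. -/
def Converter.id (I : Interface) : Converter I I where
  State := Unit
  start := ()
  step _ q := .query q fun r => .ret (r, ())

/-- Attach one converter to each of the interfaces of a resource. -/
noncomputable def Resource.attach {ι : Type} [DecidableEq ι] {I J : ι → Interface}
    (R : Resource (Interface.joint I)) (π : (i : ι) → Converter (J i) (I i)) :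
    Resource (Interface.joint J) where
  State := R.State × ((i : ι) → (π i).State)
  start := R.start.map fun s => (s, fun i => (π i).start)
  step s q :=
    (((π q.1).step (s.2 q.1) q.2).run (fun t (q' : (I q.1).Q) => R.step t ⟨q.1, q'⟩) s.1).map
      fun r => (r.1.1, (r.2, Function.update s.2 q.1 r.1.2))

/-- Rename queries (`f`) and answers (`g`) of a resource. -/
noncomputable def Resource.relabel {I J : Interface} (R : Resource I) (f : J.Q → I.Q)
    (g : (q : J.Q) → I.R (f q) → J.R q) : Resource J where
  State := R.State
  start := R.start
  step s q := (R.step s (f q)).map fun r => (g q r.1, r.2)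

/-- A distinguisher for systems with interface `I`: it has access to the whole interface and
outputs a bit. -/
abbrev Distinguisher (I : Interface) := Prog I Bool

/-- The probability that the distinguisher outputs `true` when it is connected to `R`. -/
noncomputable def Resource.probTrue {I : Interface} (R : Resource I) (D : Distinguisher I) : ℝ :=
  (((R.start.bind fun s => D.run R.step s).map Prod.fst) true).toReal

/-- The distinguishing advantage of `D` between two resources. -/
noncomputable def advantage {I : Interface} (R S : Resource I) (D : Distinguisher I) : ℝ :=
  |R.probTrue D - S.probTrue D|

theorem advantage_le_one {I : Interface} (R S : Resource I) (D : Distinguisher I) :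
    advantage R S D ≤ 1 := by
  have h : ∀ p : PMF Bool, 0 ≤ (p true).toReal ∧ (p true).toReal ≤ 1 := fun p =>
    ⟨ENNReal.toReal_nonneg, ENNReal.toReal_le_of_le_ofReal zero_le_one (by simpa using p.coe_le_one true)⟩
  have hR := h ((R.start.bind fun s => D.run R.step s).map Prod.fst)
  have hS := h ((S.start.bind fun s => D.run S.step s).map Prod.fst)
  unfold advantage Resource.probTrue
  rw [abs_le]
  constructor <;> linarith [hR.1, hR.2, hS.1, hS.2]

/-- The distance of two resources: the supremum of the advantages of all distinguishers (a
supremum of a nonempty set of reals in `[0, 1]`). -/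
noncomputable def distance {I : Interface} (R S : Resource I) : ℝ :=
  ⨆ D : Distinguisher I, advantage R S D

/-- The sides of a two-user construction: the honest users Alice and Bob, and the adversary. -/
inductive Side
  | alice
  | bob
  | eve
  deriving DecidableEq

/-- A triple of interfaces, as a family over the sides. -/
def tri (A B E : Interface) : Side → Interface
  | .alice => A
  | .bob => B
  | .eve => E

/-- The converters that attach a simulator to the adversary's interface only. -/
def simulate {A B E E' : Interface} (σ : Converter E' E) :
    (i : Side) → Converter (tri A B E' i) (tri A B E i)
  | .alice => Converter.id A
  | .bob => Converter.id B
  | .eve => σ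

/-- The real system is a secure realization of the ideal resource within `ε`: for some simulator
at the adversary's interface of the ideal resource, the two systems have distance at most `ε`. -/
def SecureWithin {A B E E' : Interface} (real : Resource (Interface.joint (tri A B E')))
    (ideal : Resource (Interface.joint (tri A B E))) (ε : ℝ) : Prop :=
  ∃ σ : Converter E' E, distance real (ideal.attach (simulate σ)) ≤ ε

end CC

/-! ## The DSKE protocol -/

namespace DSKE

open CC

/-- What Bob reconstructs from `k` received messages with common key identifier and common
secret-authenticating tag: these two, and the reconstructed vector `u ‖ S`. -/
structure Candidate (F : Type) (m kidLen : ℕ) where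
  kid : Fin kidLen → F
  Y₀ : Fin (3 + m) → F
  o : F

/-- The public parameters of an execution between Alice and Bob. Identifiers of users are
sequences of `idLen` field elements, key identifiers are sequences of `kidLen` field elements. -/
structure Params (F : Type) [Field F] [Fintype F] where
  /-- number of Security Hubs -/
  n : ℕ
  /-- threshold -/
  k : ℕ
  /-- number of field elements of the final secret -/
  m : ℕ
  one_le_k : 1 ≤ k
  k_le_n : k ≤ n
  idLen : ℕ
  kidLen : ℕ
  /-- evaluation points; hub `i : Fin n` has the point `x i.succ`, the secret is at `x 0` -/
  x : Fin (n + 1) → F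
  x_injective : Function.Injective x
  /-- encoding of table offsets as field elements -/
  g : Fin (Fintype.card F) ≃ F
  /-- Alice's identifier -/
  idA : Fin idLen → F
  /-- Bob's identifier -/
  idB : Fin idLen → F
  /-- the key identifier chosen by Alice for this execution -/
  kid : Fin kidLen → F
  /-- Bob's rule for taking some tuple among the validated ones -/
  pick : Set (Candidate F m kidLen) → Candidate F m kidLen
  pick_mem : ∀ s : Set (Candidate F m kidLen), s.Nonempty → pick s ∈ s

/-- The message `A ‖ B ‖ K ‖ g(j) ‖ Z ‖ o`. -/
structure Msg (F : Type) (m idLen kidLen : ℕ) where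
  A : Fin idLen → F
  B : Fin idLen → F
  kid : Fin kidLen → F
  offset : F
  Z : Fin (3 + m) → F
  o : F

/-- The message as a sequence of field elements. -/
def Msg.toList {F : Type} {m idLen kidLen : ℕ} (M : Msg F m idLen kidLen) : List F :=
  List.ofFn M.A ++ List.ofFn M.B ++ List.ofFn M.kid ++ [M.offset] ++ List.ofFn M.Z ++ [M.o]

/-- The hash family of message tags, `h_{c,d}(y₁, …, y_s) = d + ∑ j, c ^ j * y_j`. -/
def msgHash {F : Type} [Field F] (c d : F) (y : List F) : F :=
  d + ∑ j ∈ Finset.range y.length, c ^ (j + 1) * y.getD j 0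

/-- The hash family of secret-authenticating tags,
`h'_{c,d,e}(y₁, …, y_m) = d + c * e + ∑ j, c ^ (j + 1) * y_j`. -/
def secretHash {F : Type} [Field F] {m : ℕ} (c d e : F) (y : Fin m → F) : F :=
  d + c * e + ∑ j : Fin m, c ^ ((j : ℕ) + 2) * y j

/-- The secret part `S` of a vector `u ‖ S`. -/
def secret {F : Type} {m : ℕ} (Y₀ : Fin (3 + m) → F) : Fin m → F :=
  fun j => Y₀ (Fin.natAdd 3 j)

/-- The tag `h'_u(S)` of a vector `u ‖ S` with `u = (c, d, e)`. -/
def secretTag {F : Type} [Field F] {m : ℕ} (Y₀ : Fin (3 + m) → F) : F :=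
  secretHash (Y₀ (Fin.castAdd m 0)) (Y₀ (Fin.castAdd m 1)) (Y₀ (Fin.castAdd m 2)) (secret Y₀)

section Protocol

variable {F : Type} [Field F] [Fintype F] [DecidableEq F] (P : Params F)

/-- Number of field elements in an authenticated message. -/
def Params.s : ℕ := 2 * P.idLen + P.kidLen + 1 + (3 + P.m) + 1

abbrev Params.Message : Type := Msg F P.m P.idLen P.kidLen

/-- A message together with its tag. -/
abbrev Params.Tagged : Type := P.Message × F

abbrev Params.Vec : Type := Fin (3 + P.m) → F

/-- The table of pre-shared random data of one user with one hub, as far as one execution uses it: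
a one-time pad `R` of `3 + m` elements and a tag key `v = (c, d)`. -/
abbrev Params.Segment : Type := P.Vec × F × F

/-- What both users obtain: the key identifier and the secret. -/
abbrev Params.Result : Type := (Fin P.kidLen → F) × (Fin P.m → F)

/-- The encoded offset of the segment. As the table consists of one segment, a complete segment is
available at the offset `0` only. -/
def Params.offset : F := P.g ⟨0, Fintype.card_pos⟩

/-- The message tag. -/
def Params.tag (t : P.Segment) (M : P.Message) : F := msgHash t.2.1 t.2.2 M.toList

/-- The value at `z` of the polynomials of degree less than `#T` (one for each coordinate) through
the shares `Y i` of the hubs `i ∈ T`. -/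
noncomputable def Params.interp (T : Finset (Fin P.n)) (Y : Fin P.n → P.Vec) (z : F) : P.Vec :=
  fun l => (Lagrange.interpolate T (fun i => P.x i.succ) (fun i => Y i l)).eval z

/-- The first `k` hubs. -/
def Params.firstHubs : Finset (Fin P.n) := Finset.univ.filter fun i => i.val < P.k

/-! ### Alice -/

/-- Alice's shares from her tables. -/
noncomputable def Params.share (t : Fin P.n → P.Segment) (i : Fin P.n) : P.Vec :=
  if i.val < P.k then (t i).1 else P.interp P.firstHubs (fun i => (t i).1) (P.x i.succ)

/-- Alice's vector `u ‖ S`. -/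
noncomputable def Params.aliceY₀ (t : Fin P.n → P.Segment) : P.Vec :=
  P.interp P.firstHubs (fun i => (t i).1) (P.x 0)

/-- Alice's message to hub `i`. -/
noncomputable def Params.aliceMsg (t : Fin P.n → P.Segment) (i : Fin P.n) : P.Message where
  A := P.idA
  B := P.idB
  kid := P.kid
  offset := P.offset
  Z := P.share t i - (t i).1
  o := secretTag (P.aliceY₀ t)

noncomputable def Params.aliceSend (t : Fin P.n → P.Segment) (i : Fin P.n) : P.Tagged :=
  (P.aliceMsg t i, P.tag (t i) (P.aliceMsg t i))

/-! ### Receiving a message, at a hub or at Bob -/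

/-- The checks that precede the use of the table. A message that fails them is discarded and does
not deplete the table. -/
def Params.admissible (M : P.Tagged) : Bool :=
  decide (M.1.A = P.idA ∧ M.1.B = P.idB ∧ M.1.offset = P.offset)

/-- The message that depletes the table segment: the first admissible one of those received. All
later ones are discarded, as the segment has been used. -/
def Params.first (l : List P.Tagged) : Option P.Tagged := l.find? P.admissible

/-- The validation of the message tag. -/
def Params.validTag (t : P.Segment) (M : P.Tagged) : Prop := M.2 = P.tag t M.1

instance (t : P.Segment) (M : P.Tagged) : Decidable (P.validTag t M) :=
  inferInstanceAs (Decidable (M.2 = P.tag t M.1))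

/-- The share in a message. -/
def Params.decrypt (t : P.Segment) (M : P.Message) : P.Vec := M.Z + t.1

/-! ### Hub -/

/-- The hub's message to Bob, from the message `M` of Alice, Alice's segment and Bob's segment. -/
def Params.hubMsg (tA tB : P.Segment) (M : P.Message) : P.Message where
  A := M.A
  B := M.B
  kid := M.kid
  offset := P.offset
  Z := P.decrypt tA M - tB.1
  o := M.o

def Params.hubSend (tA tB : P.Segment) (M : P.Message) : P.Tagged :=
  (P.hubMsg tA tB M, P.tag tB (P.hubMsg tA tB M))

/-! ### Bob -/

/-- The message that Bob accepts from a hub, if any, from the list of messages received. -/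
def Params.accepted (t : P.Segment) (l : List P.Tagged) : Option P.Message :=
  match P.first l with
  | none => none
  | some M => if P.validTag t M then some M.1 else none

/-- The candidates: one for each set of `k` accepted messages with common key identifier and
secret-authenticating tag. -/
def Params.candidates (t : Fin P.n → P.Segment) (l : Fin P.n → List P.Tagged) :
    Set (Candidate F P.m P.kidLen) :=
  {c | ∃ (T : Finset (Fin P.n)) (M : Fin P.n → P.Message), T.card = P.k ∧
    (∀ i ∈ T, P.accepted (t i) (l i) = some (M i) ∧ (M i).kid = c.kid ∧ (M i).o = c.o) ∧
    c.Y₀ = P.interp T (fun i => P.decrypt (t i) (M i)) (P.x 0)}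

/-- The candidates that pass the secret validation. -/
def Params.validated (t : Fin P.n → P.Segment) (l : Fin P.n → List P.Tagged) :
    Set (Candidate F P.m P.kidLen) :=
  {c | c ∈ P.candidates t l ∧ c.o = secretTag c.Y₀}

open Classical in
/-- Bob's result; `none` stands for abort. -/
noncomputable def Params.bobResult (t : Fin P.n → P.Segment) (l : Fin P.n → List P.Tagged) :
    Option P.Result :=
  if (P.validated t l).Nonempty then
    some ((P.pick (P.validated t l)).kid, secret (P.pick (P.validated t l)).Y₀)
  else none

/-! ### The assumed resource: tables and insecure channels -/

variable (C : Finset (Fin P.n))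

/-- The parties, when the hubs in `C` are compromised and hence played by Eve. -/
inductive Params.Party
  | alice
  | bob
  | hub (i : {i : Fin P.n // i ∉ C})
  | eve
  deriving DecidableEq

inductive Params.AliceQuery
  | tables
  | send (M : Fin P.n → P.Tagged)

inductive BobQuery
  | tables
  | receive

inductive Params.HubQuery
  | tables
  | receive
  | send (M : P.Tagged)

/-- Eve sees every message, she decides which messages arrive at the receivers (in the name of
Alice or of a hub), and she determines the tables that the compromised hubs give to the users. -/
inductive Params.EveQuery
  | seeAlice (i : Fin P.n)
  | seeHub (i : Fin P.n)
  | toHub (i : Fin P.n) (M : P.Tagged)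
  | toBob (i : Fin P.n) (M : P.Tagged)
  | setTableA (i : {i : Fin P.n // i ∈ C}) (t : P.Segment)
  | setTableB (i : {i : Fin P.n // i ∈ C}) (t : P.Segment)

def Params.aliceNet : Interface where
  Q := P.AliceQuery
  R
    | .tables => Fin P.n → P.Segment
    | .send _ => Unit

def Params.bobNet : Interface where
  Q := BobQuery
  R
    | .tables => Fin P.n → P.Segment
    | .receive => Fin P.n → List P.Tagged

def Params.hubNet : Interface where
  Q := P.HubQuery
  R
    | .tables => P.Segment × P.Segment
    | .receive => List P.Tagged
    | .send _ => Unit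

def Params.eveNet : Interface where
  Q := P.EveQuery C
  R
    | .seeAlice _ => Option P.Tagged
    | .seeHub _ => Option P.Tagged
    | .toHub _ _ => Unit
    | .toBob _ _ => Unit
    | .setTableA _ _ => Unit
    | .setTableB _ _ => Unit

def Params.net : P.Party C → Interface
  | .alice => P.aliceNet
  | .bob => P.bobNet
  | .hub _ => P.hubNet
  | .eve => P.eveNet C

structure Params.NetState where
  /-- table segments shared by the hubs with Alice -/
  tA : Fin P.n → P.Segment
  /-- table segments shared by the hubs with Bob -/
  tB : Fin P.n → P.Segment
  /-- what Alice has sent to each hub -/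
  fromAlice : Fin P.n → Option P.Tagged
  /-- what each hub has received, in order of arrival -/
  atHub : Fin P.n → List P.Tagged
  /-- what each hub has sent to Bob -/
  fromHub : Fin P.n → Option P.Tagged
  /-- what Bob has received in the name of each hub, in order of arrival -/
  atBob : Fin P.n → List P.Tagged

/-- The initial state: the table segments of honest hubs are independent and uniform, those of
compromised hubs are zero until Eve sets them. -/
def Params.netStart (t : (Fin P.n → P.Segment) × (Fin P.n → P.Segment)) : P.NetState where
  tA i := if i ∈ C then 0 else t.1 i
  tB i := if i ∈ C then 0 else t.2 i
  fromAlice _ := none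
  atHub _ := []
  fromHub _ := none
  atBob _ := []

/-- The reaction of the assumed resource to a query. -/
def Params.netStep (s : P.NetState) :
    (q : (Interface.joint (P.net C)).Q) → (Interface.joint (P.net C)).R q × P.NetState
  | ⟨.alice, .tables⟩ => (s.tA, s)
  | ⟨.alice, .send M⟩ => ((), { s with fromAlice := fun i => some (M i) })
  | ⟨.bob, .tables⟩ => (s.tB, s)
  | ⟨.bob, .receive⟩ => (s.atBob, s)
  | ⟨.hub i, .tables⟩ => ((s.tA i, s.tB i), s)
  | ⟨.hub i, .receive⟩ => (s.atHub i, s)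
  | ⟨.hub i, .send M⟩ => ((), { s with fromHub := Function.update s.fromHub i (some M) })
  | ⟨.eve, .seeAlice i⟩ => (s.fromAlice i, s)
  | ⟨.eve, .seeHub i⟩ => (s.fromHub i, s)
  | ⟨.eve, .toHub i M⟩ => ((), { s with atHub := Function.update s.atHub i (s.atHub i ++ [M]) })
  | ⟨.eve, .toBob i M⟩ => ((), { s with atBob := Function.update s.atBob i (s.atBob i ++ [M]) })
  | ⟨.eve, .setTableA i t⟩ => ((), { s with tA := Function.update s.tA i t })
  | ⟨.eve, .setTableB i t⟩ => ((), { s with tB := Function.update s.tB i t })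

noncomputable def Params.network : Resource (Interface.joint (P.net C)) where
  State := P.NetState
  start := (PMF.uniformOfFintype ((Fin P.n → P.Segment) × (Fin P.n → P.Segment))).map
    (P.netStart C)
  step s q := PMF.pure (P.netStep C s q)

/-! ### The protocol as converters -/

/-- The user's interface of Alice: one query, which makes her run the protocol (if she has not done
so yet), with her result as the answer. -/
def Params.aliceUser : Interface where
  Q := Unit
  R _ := P.Result

/-- The user's interface of Bob: one query, which makes Bob end the protocol (if he has not done so
yet) with the messages received up to then, with his result as the answer. -/
def Params.bobUser : Interface where
  Q := Unit
  R _ := Option P.Result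

/-- A hub has no user; it is only activated. -/
def clock : Interface where
  Q := Unit
  R _ := Unit

/-- The interfaces of the parties once the honest ones run the protocol. -/
def Params.user : P.Party C → Interface
  | .alice => P.aliceUser
  | .bob => P.bobUser
  | .hub _ => clock
  | .eve => P.eveNet C

noncomputable def Params.aliceConverter : Converter P.aliceUser P.aliceNet where
  State := Option P.Result
  start := none
  step
    | some r, _ => .ret (r, some r)
    | none, _ =>
      .query .tables fun (t : Fin P.n → P.Segment) =>
      .query (.send (P.aliceSend t)) fun _ =>
      .ret ((P.kid, secret (P.aliceY₀ t)), some (P.kid, secret (P.aliceY₀ t)))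

/-- The state tells whether the table segments have been used. -/
def Params.hubConverter : Converter clock P.hubNet where
  State := Bool
  start := false
  step
    | true, _ => .ret ((), true)
    | false, _ =>
      .query .receive fun (l : List P.Tagged) =>
      match P.first l with
      | none => .ret ((), false)
      | some M =>
        .query .tables fun (t : P.Segment × P.Segment) =>
        if P.validTag t.1 M then
          .query (.send (P.hubSend t.1 t.2 M.1)) fun _ => .ret ((), true)
        else .ret ((), true)

noncomputable def Params.bobConverter : Converter P.bobUser P.bobNet where
  State := Option (Option P.Result)
  start := none
  step
    | some r, _ => .ret (r, some r)
    | none, _ =>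
      .query .tables fun (t : Fin P.n → P.Segment) =>
      .query .receive fun (l : Fin P.n → List P.Tagged) =>
      .ret (P.bobResult t l, some (P.bobResult t l))

noncomputable def Params.protocol : (p : P.Party C) → Converter (P.user C p) (P.net C p)
  | .alice => P.aliceConverter
  | .bob => P.bobConverter
  | .hub _ => P.hubConverter
  | .eve => Converter.id (P.eveNet C)

/-- Eve's interface in the real system: her access to the network and the compromised hubs, and the
scheduling of the honest hubs. -/
def Params.realEve : Interface where
  Q := P.EveQuery C ⊕ {i : Fin P.n // i ∉ C}
  R
    | .inl q => (P.eveNet C).R q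
    | .inr _ => Unit

def Params.route : (Interface.joint (tri P.aliceUser P.bobUser (P.realEve C))).Q →
    (Interface.joint (P.user C)).Q
  | ⟨.alice, q⟩ => ⟨.alice, q⟩
  | ⟨.bob, q⟩ => ⟨.bob, q⟩
  | ⟨.eve, .inl q⟩ => ⟨.eve, q⟩
  | ⟨.eve, .inr i⟩ => ⟨.hub i, ()⟩

def Params.routeBack : (q : (Interface.joint (tri P.aliceUser P.bobUser (P.realEve C))).Q) →
    (Interface.joint (P.user C)).R (P.route C q) →
    (Interface.joint (tri P.aliceUser P.bobUser (P.realEve C))).R q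
  | ⟨.alice, _⟩, r => r
  | ⟨.bob, _⟩, r => r
  | ⟨.eve, .inl _⟩, r => r
  | ⟨.eve, .inr _⟩, r => r

/-- The real system: the honest parties run the protocol on the assumed resource. -/
noncomputable def Params.real :
    Resource (Interface.joint (tri P.aliceUser P.bobUser (P.realEve C))) :=
  ((P.network C).attach (P.protocol C)).relabel (P.route C) (P.routeBack C)

/-! ### The ideal resource: a uniform secret for Alice, and the same secret or abort for Bob -/

/-- Eve learns whether Alice has started and controls a switch that lets Bob have the secret. -/
inductive IdealEveQuery
  | started
  | setSwitch (b : Bool)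

def idealEve : Interface where
  Q := IdealEveQuery
  R
    | .started => Bool
    | .setSwitch _ => Unit

structure Params.IdealState where
  S : Fin P.m → F
  started : Bool
  switch : Bool
  bob : Option (Option P.Result)

/-- Bob's result, at the moment when he asks for it. -/
def Params.idealBob (s : P.IdealState) : Option P.Result :=
  match s.bob with
  | some r => r
  | none => if s.started && s.switch then some (P.kid, s.S) else none

def Params.idealStep (s : P.IdealState) :
    (q : (Interface.joint (tri P.aliceUser P.bobUser idealEve)).Q) →
      (Interface.joint (tri P.aliceUser P.bobUser idealEve)).R q × P.IdealState
  | ⟨.alice, _⟩ => ((P.kid, s.S), { s with started := true })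
  | ⟨.bob, _⟩ => (P.idealBob s, { s with bob := some (P.idealBob s) })
  | ⟨.eve, .started⟩ => (s.started, s)
  | ⟨.eve, .setSwitch b⟩ => ((), { s with switch := b })

noncomputable def Params.ideal :
    Resource (Interface.joint (tri P.aliceUser P.bobUser idealEve)) where
  State := P.IdealState
  start := (PMF.uniformOfFintype (Fin P.m → F)).map fun S => ⟨S, false, false, none⟩
  step s q := PMF.pure (P.idealStep s q)

/-- The DSKE protocol is `ε`-secure: whenever fewer than `k` hubs are compromised, the real system
is a secure realization of the ideal secret-key resource within `ε`. -/
def Params.IsSecure (ε : ℝ) : Prop :=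
  ∀ C : Finset (Fin P.n), C.card < P.k → SecureWithin (P.real C) P.ideal ε

end Protocol

/-- The authenticated messages consist of `s` field elements. -/
theorem Params.length_toList {F : Type} [Field F] [Fintype F] (P : Params F) (M : P.Message) :
    M.toList.length = P.s := by
  simp only [Msg.toList, List.length_append, List.length_ofFn, List.length_singleton, Params.s]
  omega

end DSKE

/-!
Conditioned on everything that Eve, Alice's user and Bob's user have observed, the secret data of
the honest parties are still uniform, up to what the observations determine. With fewer than `k`
compromised hubs the linear map from the pads of the honest hubs to Alice's vector `u ‖ S` and to
the differences `Z i` (for the hubs after the first `k`) is surjective, by Lagrange interpolation at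
`x 0` and at the points of the compromised hubs (`Params.surjective_padMap`). So `S`, the `Z i`,
the secret-authenticating tag (through the entry `d` of `u`) and the message tags (through the
second entries of the keys) are jointly uniform and independent of the entries `c`, `e` of `u` and
of the first entries of the keys (`Params.exists_isTableEquiv`). The simulator samples these
messages once Alice has started, lets an honest hub react only to what Alice has sent to it, and
sets the switch of the ideal resource when some `k` accepted messages lead to Alice's secret; by
linearity of interpolation this can be read off from the deviations of the shares of the
compromised hubs.

The proof is an approximate simulation (`Prog.run_le_of_approx`). The states of a system in which
the secret is sampled only when Alice starts (`Params.lazyStep`) serve as views; a kernel assigns to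
each view the distribution of the state of the real system. One step respects the kernel, except
for the forgeries that it makes possible, and their probability is taken from a budget: at most
`s / |F|` once for each honest hub, and, when Bob ends the protocol, `s / |F|` for each hub and
`(m + 1) / |F|` for each set of `k` hubs. The bounds are numbers of roots of polynomials
(`ncard_msgHash_forge_le`, `ncard_secretTag_forge_le`). A rejected forgery costs no conditioning: the
hidden keys keep their uniform distribution in the description, as the two systems are
compared with the same keys. A second kernel, without error, connects the lazy system with the ideal
resource and the simulator (`Params.eager_step`).
-/

/-! ### Distributions up to a statistical error -/

open CC

namespace PMF

/-- `p` is within `c` of `q` in total variation distance, in the form in which it is used: the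
expectation of any test function with values in `[0, 1]` is larger under `p` by at most `c`. -/
def ApproxLE {α : Type*} (c : ENNReal) (p q : PMF α) : Prop :=
  ∀ f : α → ENNReal, (∀ x, f x ≤ 1) → ∑' x, p x * f x ≤ ∑' x, q x * f x + c

theorem ApproxLE.of_eq {α : Type*} {c : ENNReal} {p q : PMF α} (h : p = q) : ApproxLE c p q :=
  fun _ _ => h ▸ le_self_add

theorem tsum_bind_mul {α β : Type*} (p : PMF α) (g : α → PMF β) (f : β → ENNReal) :
    ∑' y, (p.bind g) y * f y = ∑' x, p x * ∑' y, g x y * f y := by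
  simp only [bind_apply, ← ENNReal.tsum_mul_right, ← ENNReal.tsum_mul_left]
  rw [ENNReal.tsum_comm]
  simp only [mul_assoc]

theorem tsum_map_mul {α β : Type*} (p : PMF α) (g : α → β) (f : β → ENNReal) :
    ∑' y, (p.map g) y * f y = ∑' x, p x * f (g x) := by
  rw [← bind_pure_comp, tsum_bind_mul]
  simp

theorem ApproxLE.bind {α β : Type*} {c : ENNReal} (p : PMF α) {g h : α → PMF β}
    (H : ∀ x ∈ p.support, ApproxLE c (g x) (h x)) : ApproxLE c (p.bind g) (p.bind h) := by
  intro f hf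
  rw [tsum_bind_mul, tsum_bind_mul]
  calc ∑' x, p x * ∑' y, g x y * f y ≤ ∑' x, (p x * ∑' y, h x y * f y + p x * c) := by
        refine ENNReal.tsum_le_tsum fun x => ?_
        rw [← mul_add]
        by_cases hx : p x = 0
        · simp [hx]
        · gcongr
          exact H x ((mem_support_iff _ _).2 hx) f hf
    _ = _ := by rw [ENNReal.tsum_add, ENNReal.tsum_mul_right, p.tsum_coe, one_mul]

/-- Two functions of the same random variable that agree outside an event are as close as the event
is improbable. -/
theorem ApproxLE.map_of_eqOn {α β : Type*} (p : PMF α) {g h : α → β} (bad : Set α)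
    (H : ∀ x, x ∉ bad → g x = h x) : ApproxLE (p.toOuterMeasure bad) (p.map g) (p.map h) := by
  intro f hf
  rw [tsum_map_mul, tsum_map_mul, toOuterMeasure_apply, ← ENNReal.tsum_add]
  refine ENNReal.tsum_le_tsum fun x => ?_
  by_cases hx : x ∈ bad
  · rw [Set.indicator_of_mem hx]
    exact (mul_le_of_le_one_right' (hf _)).trans le_add_self
  · rw [H x hx]
    exact le_self_add

theorem ApproxLE.mono {α : Type*} {c d : ENNReal} {p q : PMF α} (h : ApproxLE c p q)
    (hcd : c ≤ d) : ApproxLE d p q :=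
  fun f hf => (h f hf).trans (by gcongr)

theorem ApproxLE.trans_eq {α : Type*} {c : ENNReal} {p q r : PMF α} (h : ApproxLE c p q)
    (hqr : q = r) : ApproxLE c p r :=
  hqr ▸ h

/-! ### Uniform distributions -/

section Uniform

variable {A X Y : Type*} [Fintype A] [Nonempty A] [Fintype X] [Nonempty X] [Fintype Y] [Nonempty Y]

theorem uniformOfFintype_map_equiv (e : A ≃ X) :
    (uniformOfFintype A).map e = uniformOfFintype X := by
  ext x
  rw [map_apply, tsum_eq_single (e.symm x)]
  · simp [uniformOfFintype_apply, Fintype.card_congr e]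
  · intro b hb
    rw [if_neg]
    rintro rfl
    simp at hb

theorem uniformOfFintype_prod :
    uniformOfFintype (X × Y) =
      (uniformOfFintype X).bind fun x => (uniformOfFintype Y).map (Prod.mk x) := by
  ext ⟨x, y⟩
  rw [bind_apply, tsum_eq_single x]
  · rw [map_apply, tsum_eq_single y]
    · simp only [uniformOfFintype_apply, Fintype.card_prod, Nat.cast_mul, if_true]
      rw [ENNReal.mul_inv] <;> simp
    · intro b hb
      rw [if_neg]
      simpa using hb.symm
  · intro b hb
    rw [map_apply, ENNReal.tsum_eq_zero.2, mul_zero]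
    intro c
    rw [if_neg]
    intro h
    exact hb (Prod.ext_iff.1 h).1.symm

theorem uniformOfFintype_map_snd :
    (uniformOfFintype (X × Y)).map Prod.snd = uniformOfFintype Y := by
  rw [uniformOfFintype_prod, map_bind]
  simp only [map_comp]
  change ((uniformOfFintype X).bind fun _ => (uniformOfFintype Y).map _root_.id) = _
  rw [map_id, bind_const]

/-- Replacing one of several coordinates of a uniform element by an independent uniform value. -/
theorem uniformOfFintype_resample {Z : Type*} [Finite Z] [Nonempty Z] (e : A ≃ X × Z) :
    uniformOfFintype A =
      (uniformOfFintype X).bind fun x => (uniformOfFintype A).map fun a => e.symm (x, (e a).2) := by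
  have := Fintype.ofFinite Z
  have h2 : (uniformOfFintype A).map (fun a => (e a).2) = uniformOfFintype Z := by
    rw [← uniformOfFintype_map_snd (X := X) (Y := Z), ← uniformOfFintype_map_equiv e, map_comp]
    rfl
  calc uniformOfFintype A = (uniformOfFintype (X × Z)).map e.symm :=
        (uniformOfFintype_map_equiv e.symm).symm
    _ = (uniformOfFintype X).bind fun x => (uniformOfFintype Z).map fun y => e.symm (x, y) := by
        rw [uniformOfFintype_prod, map_bind]
        simp only [map_comp]
        rfl
    _ = _ := by
        rw [← h2]
        simp only [map_comp]
        rfl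

theorem uniformOfFintype_resample_fst {B Z : Type*} [Fintype B] [Nonempty B] [Finite Z]
    [Nonempty Z] (e : A ≃ X × Z) :
    uniformOfFintype (A × B) = (uniformOfFintype X).bind fun x =>
      (uniformOfFintype (A × B)).map fun w => (e.symm (x, (e w.1).2), w.2) :=
  uniformOfFintype_resample ((e.prodCongr (Equiv.refl B)).trans (Equiv.prodAssoc X Z B))

/-- Resampling a part of the value at `i` of a uniform function; how the value is split into parts
may depend on an independent variable. -/
theorem uniformOfFintype_resample_eval {B Z ι : Type*} [Fintype B] [Nonempty B] [Finite Z]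
    [Nonempty Z] [Fintype ι] [DecidableEq ι] (e : B → A ≃ X × Z) (i : ι) :
    uniformOfFintype (B × (ι → A)) = (uniformOfFintype X).bind fun x =>
      (uniformOfFintype (B × (ι → A))).map fun w =>
        (w.1, Function.update w.2 i ((e w.1).symm (x, (e w.1 (w.2 i)).2))) := by
  have h : ∀ b, uniformOfFintype (ι → A) = (uniformOfFintype X).bind fun x =>
      (uniformOfFintype (ι → A)).map fun g =>
        Function.update g i ((e b).symm (x, (e b (g i)).2)) := by
    intro b
    refine (uniformOfFintype_resample (((Equiv.funSplitAt i A).trans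
      ((e b).prodCongr (Equiv.refl _))).trans (Equiv.prodAssoc _ _ _))).trans ?_
    refine congrArg (PMF.bind _) (funext fun x => congrFun (congrArg PMF.map (funext fun g => ?_)) _)
    funext j
    by_cases hj : j = i
    · subst hj
      simp [Equiv.funSplitAt, Equiv.piSplitAt]
    · simp [Equiv.funSplitAt, Equiv.piSplitAt, hj]
  calc uniformOfFintype (B × (ι → A)) = (uniformOfFintype B).bind fun b =>
        ((uniformOfFintype X).bind fun x => (uniformOfFintype (ι → A)).map fun g =>
          Function.update g i ((e b).symm (x, (e b (g i)).2))).map (Prod.mk b) := by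
        rw [uniformOfFintype_prod]
        congr 1
        funext b
        rw [← h b]
    _ = _ := by
        simp only [uniformOfFintype_prod, map_bind, map_comp]
        rw [bind_comm]
        rfl

theorem uniformOfFintype_map_fst :
    (uniformOfFintype (X × Y)).map Prod.fst = uniformOfFintype X := by
  rw [← uniformOfFintype_map_equiv (Equiv.prodComm Y X), map_comp]
  exact uniformOfFintype_map_snd

theorem uniformOfFintype_map_eval {ι : Type*} [Fintype ι] [DecidableEq ι] (i : ι) :
    (uniformOfFintype (ι → A)).map (fun g => g i) = uniformOfFintype A := by
  have h := uniformOfFintype_map_fst (X := A) (Y := {j // j ≠ i} → A)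
  rw [← uniformOfFintype_map_equiv (Equiv.funSplitAt i A), map_comp] at h
  exact h

/-- An event that forces a uniform variable into a set of at most `N` values. -/
theorem toOuterMeasure_le_of_map_eq_uniform {Ω : Type*} {p : PMF Ω} {π : Ω → X}
    (hπ : p.map π = uniformOfFintype X) {bad : Set Ω} {V : Set X}
    (h : ∀ w ∈ bad, π w ∈ V) {N : ℕ} (hV : V.ncard ≤ N) :
    p.toOuterMeasure bad ≤ N / Fintype.card X := by
  classical
  calc p.toOuterMeasure bad ≤ p.toOuterMeasure (π ⁻¹' V) := MeasureTheory.measure_mono h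
    _ = (p.map π).toOuterMeasure V := (toOuterMeasure_map_apply π p V).symm
    _ ≤ _ := by
      rw [hπ, toOuterMeasure_uniformOfFintype_apply]
      gcongr
      rwa [← Nat.card_eq_fintype_card, Nat.card_coe_set_eq]

end Uniform

end PMF

/-! ### Approximate simulation of interactive systems -/

namespace CC

/-- The step of a resource with attached converters, from the run of the converter concerned. -/
theorem Resource.attach_step_eq {ι : Type} [DecidableEq ι] {I J : ι → Interface}
    {R : Resource (Interface.joint I)} {π : (i : ι) → Converter (J i) (I i)} {X : Type*}
    {s : R.State} {σ : (i : ι) → (π i).State} {i : ι} {q : (J i).Q} {p : PMF X}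
    {h : X → ((J i).R q × (π i).State) × R.State}
    (hrun : ((π i).step (σ i) q).run (fun t (q' : (I i).Q) => R.step t ⟨i, q'⟩) s = p.map h)
    {g : X → (J i).R q × (R.attach π).State}
    (hg : ∀ x, ((h x).1.1, ((h x).2, Function.update σ i (h x).1.2)) = g x) :
    (R.attach π).step (s, σ) ⟨i, q⟩ = p.map g := by
  refine (congrArg (PMF.map _) hrun).trans ((PMF.map_comp _ _ _).trans ?_)
  exact congrFun (congrArg PMF.map (funext hg)) p

theorem Resource.attach_step_pure {ι : Type} [DecidableEq ι] {I J : ι → Interface}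
    {R : Resource (Interface.joint I)} {π : (i : ι) → Converter (J i) (I i)}
    {s t : R.State} {σ σ' : (i : ι) → (π i).State} {i : ι} {q : (J i).Q} {y : (J i).R q}
    {x : (π i).State}
    (hrun : ((π i).step (σ i) q).run (fun t (q' : (I i).Q) => R.step t ⟨i, q'⟩) s =
      PMF.pure ((y, x), t))
    (hσ : Function.update σ i x = σ') :
    (R.attach π).step (s, σ) ⟨i, q⟩ = PMF.pure (y, (t, σ')) :=
  (congrArg (PMF.map _) hrun).trans ((PMF.pure_map _ _).trans (by rw [hσ]; rfl))

/-- Approximate simulation. The state of a system `SR` is described by the state `l` of a system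
`SL`: conditioned on what has been observed it has the distribution `κ l`. If every step
respects this up to a cost that is taken from the budget `β`, the outcome of
any computation is at most `β l` more likely with `SR` than with `SL`. -/
theorem Prog.run_le_of_approx {I : Interface} {α SR SL : Type}
    (stepR : SR → (q : I.Q) → PMF (I.R q × SR)) (stepL : SL → (q : I.Q) → PMF (I.R q × SL))
    (κ : SL → PMF SR) (inv : SL → Prop) (β : SL → ENNReal)
    (h : ∀ l, inv l → ∀ q, ∃ c,
      PMF.ApproxLE c ((κ l).bind fun s => stepR s q)
        ((stepL l q).bind fun r => (κ r.2).map (Prod.mk r.1)) ∧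
      ∀ r ∈ (stepL l q).support, inv r.2 ∧ c + β r.2 ≤ β l)
    (D : Prog I α) (b : α) :
    ∀ l, inv l → ((κ l).bind fun s => (D.run stepR s).map Prod.fst) b ≤
      ((D.run stepL l).map Prod.fst) b + β l := by
  induction D with
  | ret a =>
    intro l hl
    simp only [Prog.run, PMF.pure_map, PMF.bind_const]
    exact le_self_add
  | sample Ω p next ih =>
    intro l hl
    simp only [Prog.run, PMF.map_bind]
    rw [PMF.bind_comm, PMF.bind_apply, PMF.bind_apply]
    calc _ ≤ ∑' w, (p w * (((next w).run stepL l).map Prod.fst) b + p w * β l) := by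
          refine ENNReal.tsum_le_tsum fun w => ?_
          rw [← mul_add]
          gcongr
          exact ih w l hl
      _ = _ := by rw [ENNReal.tsum_add, ENNReal.tsum_mul_right, p.tsum_coe, one_mul]
  | query q next ih =>
    intro l hl
    obtain ⟨c, hc, hβ⟩ := h l hl q
    simp only [Prog.run, PMF.map_bind]
    have h1 := hc (fun r => (((next r.1).run stepR r.2).map Prod.fst) b)
      fun r => PMF.coe_le_one _ _
    rw [← PMF.bind_bind, PMF.bind_apply, PMF.bind_apply]
    refine h1.trans ?_
    rw [PMF.tsum_bind_mul]
    calc _ ≤ ∑' r, (stepL l q r * (((next r.1).run stepL r.2).map Prod.fst) b +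
            stepL l q r * β r.2) + c := by
          gcongr with r
          rw [← mul_add]
          by_cases hr : stepL l q r = 0
          · simp [hr]
          · gcongr
            refine le_trans (le_of_eq ?_)
              (ih r.1 r.2 (hβ r ((PMF.mem_support_iff _ _).2 hr)).1)
            rw [PMF.tsum_map_mul, PMF.bind_apply]
      _ = ∑' r, stepL l q r * (((next r.1).run stepL r.2).map Prod.fst) b +
            ∑' r, (stepL l q r * β r.2 + stepL l q r * c) := by
          rw [ENNReal.tsum_add, ENNReal.tsum_add, ENNReal.tsum_mul_right (a := c), PMF.tsum_coe,
            one_mul, add_assoc]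
      _ ≤ ∑' r, stepL l q r * (((next r.1).run stepL r.2).map Prod.fst) b +
            ∑' r, stepL l q r * β l := by
          gcongr with r
          rw [← mul_add]
          by_cases hr : stepL l q r = 0
          · simp [hr]
          · gcongr
            rw [add_comm]
            exact (hβ r ((PMF.mem_support_iff _ _).2 hr)).2
      _ = _ := by rw [ENNReal.tsum_mul_right, PMF.tsum_coe, one_mul]

end CC

/-! ### Forgeries, by counting keys -/

namespace DSKE

section Counting

variable {F : Type} [Field F]

theorem ncard_eval_fst_eq_zero_le [Fintype F] {p : Polynomial F} (hp : p ≠ 0) {N : ℕ} (hN : p.natDegree ≤ N) :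
    {z : F × F | p.eval z.1 = 0}.ncard ≤ N * Fintype.card F := by
  classical
  have h : {z : F × F | p.eval z.1 = 0} = (p.roots.toFinset ×ˢ (Finset.univ : Finset F) : Finset _) := by
    ext z
    simp [hp]
  rw [h, Set.ncard_coe_finset, Finset.card_product, Finset.card_univ]
  gcongr
  exact (Multiset.toFinset_card_le _).trans ((Polynomial.card_roots' p).trans hN)

theorem ncard_le_card_of_fst_injOn {F : Type} [Fintype F] {s : Set (F × F)} (h : s.InjOn Prod.fst) :
    s.ncard ≤ Fintype.card F := by
  rw [← h.ncard_image, ← Nat.card_eq_fintype_card]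
  exact Set.ncard_le_card _

theorem msgHash_eq_zero_add (c d : F) (y : List F) : msgHash c d y = d + msgHash c 0 y := by
  simp [msgHash]

theorem ncard_msgHash_eq_le [Fintype F] (T : F) (y : List F) :
    {v : F × F | T = msgHash v.1 v.2 y}.ncard ≤ Fintype.card F := by
  refine ncard_le_card_of_fst_injOn ?_
  rintro ⟨c, d⟩ h ⟨c', d'⟩ h' hc
  simp only at hc
  subst hc
  simp only [Set.mem_ofPred_eq, msgHash] at h h'
  rw [h] at h'
  simpa using h'

/-- Authenticity of the message tags: if one message `y` with its tag `T` is known, another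
message with a tag is valid for at most `s |F|` of the keys `(c, T - ∑ j, c ^ j * y_j)`. -/
theorem ncard_msgHash_forge_le [Fintype F] {y y' : List F} {T T' : F} {s : ℕ} (hy : y.length = s)
    (hy' : y'.length = s) (hne : (y', T') ≠ (y, T)) :
    {v : F × F | T' = msgHash v.1 (T - msgHash v.1 0 y) y'}.ncard ≤ s * Fintype.card F := by
  classical
  set p : Polynomial F := Polynomial.C (T - T') +
    ∑ j ∈ Finset.range s, Polynomial.C (y'.getD j 0 - y.getD j 0) * Polynomial.X ^ (j + 1) with hp
  have hc0 : p.coeff 0 = T - T' := by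
    simp [hp, Polynomial.coeff_X_pow]
  have hcj : ∀ j < s, p.coeff (j + 1) = y'.getD j 0 - y.getD j 0 := by
    intro j hj
    simp only [hp, Polynomial.coeff_add, Polynomial.finsetSum_coeff, Polynomial.coeff_C_mul,
      Polynomial.coeff_X_pow, Polynomial.coeff_C_succ, zero_add, mul_ite, mul_one, mul_zero,
      add_left_inj]
    rw [Finset.sum_ite_eq]
    simp [hj]
  have hp0 : p ≠ 0 := by
    intro h
    apply hne
    rw [h] at hc0 hcj
    rw [Prod.mk.injEq]
    constructor
    · refine List.ext_getElem (hy'.trans hy.symm) fun j h1 h2 => ?_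
      have := hcj j (hy' ▸ h1)
      rw [List.getD_eq_getElem _ _ h1, List.getD_eq_getElem _ _ h2, Polynomial.coeff_zero] at this
      exact (sub_eq_zero.1 this.symm)
    · exact (sub_eq_zero.1 hc0.symm).symm
  have hdeg : p.natDegree ≤ s := by
    refine Polynomial.natDegree_add_le_of_degree_le (by simp) ?_
    refine Polynomial.natDegree_sum_le_of_forall_le _ _ fun j hj => ?_
    exact (Polynomial.natDegree_C_mul_X_pow_le _ _).trans (Finset.mem_range.1 hj)
  refine le_trans (Set.ncard_le_ncard ?_ (Set.toFinite _)) (ncard_eval_fst_eq_zero_le hp0 hdeg)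
  rintro ⟨c, d⟩ h
  simp only [Set.mem_ofPred_eq, msgHash, hy, hy'] at h ⊢
  simp only [hp, Polynomial.eval_add, Polynomial.eval_C, Polynomial.eval_finsetSum,
    Polynomial.eval_mul, Polynomial.eval_pow, Polynomial.eval_X, sub_mul, Finset.sum_sub_distrib]
  rw [h]
  simp only [mul_comm (c ^ _)]
  ring

/-- The vector `u ‖ S` that has the secret `S`, the tag `o` and the entries `c`, `e` of
`u = (c, d, e)`. -/
def ofSecretTag {m : ℕ} (S : Fin m → F) (o c e : F) : Fin (3 + m) → F :=
  Fin.append ![c, o - c * e - ∑ j : Fin m, c ^ ((j : ℕ) + 2) * S j, e] S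

@[simp] theorem ofSecretTag_zero {m : ℕ} (S : Fin m → F) (o c e : F) :
    ofSecretTag S o c e (Fin.castAdd m 0) = c := by
  simp [ofSecretTag]

@[simp] theorem ofSecretTag_two {m : ℕ} (S : Fin m → F) (o c e : F) :
    ofSecretTag S o c e (Fin.castAdd m 2) = e := by
  simp [ofSecretTag]

@[simp] theorem secret_ofSecretTag {m : ℕ} (S : Fin m → F) (o c e : F) :
    secret (ofSecretTag S o c e) = S := by
  ext j
  simp [ofSecretTag, secret]

@[simp] theorem secretTag_ofSecretTag {m : ℕ} (S : Fin m → F) (o c e : F) :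
    secretTag (ofSecretTag S o c e) = o := by
  rw [secretTag, secret_ofSecretTag]
  simp [secretHash, ofSecretTag]
  ring

theorem ofSecretTag_eq_self {m : ℕ} (Y : Fin (3 + m) → F) :
    ofSecretTag (secret Y) (secretTag Y) (Y (Fin.castAdd m 0)) (Y (Fin.castAdd m 2)) = Y := by
  ext l
  refine Fin.addCases (fun i => ?_) (fun i => ?_) l
  · fin_cases i
    · exact ofSecretTag_zero ..
    · simp [ofSecretTag, secretTag, secretHash]
      ring
    · exact ofSecretTag_two ..
  · simp [ofSecretTag, secret]

/-- Authenticity of the secret: if `S` and the tag `o` are known, a nonzero shift `D` of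
`u ‖ S` passes the validation for at most `(m + 1) |F|` of the pairs `(c, e)`. -/
theorem ncard_secretTag_forge_le [Fintype F] {m : ℕ} (S : Fin m → F) (o : F) {D : Fin (3 + m) → F}
    (hD : D ≠ 0) :
    {v : F × F | o = secretTag (ofSecretTag S o v.1 v.2 + D)}.ncard ≤
      (m + 1) * Fintype.card F := by
  classical
  have htag : ∀ c e, secretTag (ofSecretTag S o c e + D) =
      (o - c * e - ∑ j : Fin m, c ^ ((j : ℕ) + 2) * S j + D (Fin.castAdd m 1)) +
      (c + D (Fin.castAdd m 0)) * (e + D (Fin.castAdd m 2)) +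
      ∑ j : Fin m, (c + D (Fin.castAdd m 0)) ^ ((j : ℕ) + 2) * (S j + D (Fin.natAdd 3 j)) := by
    intro c e
    simp [secretTag, secretHash, ofSecretTag, secret]
  by_cases h0 : D (Fin.castAdd m 0) = 0
  · -- If the entry `c` is not shifted, the condition is a polynomial equation for `c` alone.
    set p : Polynomial F := Polynomial.C (D (Fin.castAdd m 1)) +
      (Polynomial.C (D (Fin.castAdd m 2)) * Polynomial.X +
      ∑ j : Fin m, Polynomial.C (D (Fin.natAdd 3 j)) * Polynomial.X ^ ((j : ℕ) + 2)) with hp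
    have hp0 : p ≠ 0 := by
      intro h
      apply hD
      have hc : ∀ i, p.coeff i = 0 := fun i => by rw [h, Polynomial.coeff_zero]
      ext l
      refine Fin.addCases (fun i => ?_) (fun i => ?_) l
      · fin_cases i
        · exact h0
        · have := hc 0
          simpa [hp, Polynomial.finsetSum_coeff, Polynomial.coeff_C_mul,
            Polynomial.coeff_X_pow] using this
        · have := hc 1
          simpa [hp, Polynomial.finsetSum_coeff, Polynomial.coeff_C_mul,
            Polynomial.coeff_X_pow, Polynomial.coeff_C] using this
      · have := hc (i + 2)
        simp only [hp, Polynomial.coeff_add, Polynomial.finsetSum_coeff, Polynomial.coeff_C_mul,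
          Polynomial.coeff_X_pow, Polynomial.coeff_C_succ, Polynomial.coeff_X, zero_add,
          mul_ite, mul_one, mul_zero, add_left_inj, Fin.val_inj] at this
        rw [Finset.sum_ite_eq, if_neg (by omega)] at this
        simpa using this
    have hdeg : p.natDegree ≤ m + 1 := by
      refine Polynomial.natDegree_add_le_of_degree_le (by simp) ?_
      refine Polynomial.natDegree_add_le_of_degree_le ?_ ?_
      · exact (Polynomial.natDegree_C_mul_le _ _).trans (by simp)
      · refine Polynomial.natDegree_sum_le_of_forall_le _ _ fun j hj => ?_
        exact (Polynomial.natDegree_C_mul_X_pow_le _ _).trans (by omega)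
    refine le_trans (Set.ncard_le_ncard ?_ (Set.toFinite _)) (ncard_eval_fst_eq_zero_le hp0 hdeg)
    rintro ⟨c, e⟩ h
    simp only [Set.mem_ofPred_eq, htag, h0, add_zero, mul_add, Finset.sum_add_distrib] at h ⊢
    simp only [hp, Polynomial.eval_add, Polynomial.eval_C, Polynomial.eval_finsetSum,
      Polynomial.eval_mul, Polynomial.eval_pow, Polynomial.eval_X]
    simp only [mul_comm (D _)]
    linear_combination -h
  · -- Otherwise it determines `e` from `c`.
    refine (ncard_le_card_of_fst_injOn ?_).trans (Nat.le_mul_of_pos_left _ (Nat.succ_pos m))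
    rintro ⟨c, e⟩ h ⟨c', e'⟩ h' hc
    simp only at hc
    subst hc
    simp only [Set.mem_ofPred_eq, htag] at h h'
    rw [Prod.mk.injEq]
    refine ⟨rfl, mul_left_cancel₀ h0 ?_⟩
    linear_combination h' - h

end Counting

/-- A surjective linear map as the first component of a bijection. -/
theorem exists_equiv_prod_ker {F : Type} [Field F] {V W : Type} [AddCommGroup V] [Module F V] [AddCommGroup W]
    [Module F W] (f : V →ₗ[F] W) (hf : Function.Surjective f) :
    ∃ e : V ≃ W × LinearMap.ker f, ∀ v, (e v).1 = f v := by
  obtain ⟨g, hg⟩ := f.exists_rightInverse_of_surjective (LinearMap.range_eq_top.2 hf)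
  have hg' : ∀ w, f (g w) = w := fun w => LinearMap.congr_fun hg w
  refine ⟨⟨fun v => (f v, ⟨v - g (f v), by simp [hg']⟩), fun p => g p.1 + p.2.1, fun v => by simp,
    ?_⟩, fun v => rfl⟩
  rintro ⟨w, k, hk⟩
  rw [LinearMap.mem_ker] at hk
  simp [hg', hk]

theorem Msg.toList_injective {F : Type} {m idLen kidLen : ℕ} :
    Function.Injective (Msg.toList : Msg F m idLen kidLen → List F) := by
  rintro ⟨A, B, kid, off, Z, o⟩ ⟨A', B', kid', off', Z', o'⟩ h
  simp only [Msg.toList] at h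
  obtain ⟨h, h6⟩ := List.append_inj' h rfl
  obtain ⟨h, h5⟩ := List.append_inj' h (by simp)
  obtain ⟨h, h4⟩ := List.append_inj' h rfl
  obtain ⟨h, h3⟩ := List.append_inj' h (by simp)
  obtain ⟨h1, h2⟩ := List.append_inj' h (by simp)
  simp only [List.ofFn_inj, List.cons.injEq, and_true] at h1 h2 h3 h4 h5 h6
  subst h1 h2 h3 h4 h5 h6
  rfl

end DSKE

/-! ### Shamir's scheme and the distribution of Alice's messages -/

namespace DSKE

section Alice

variable {F : Type} [Field F] [Fintype F] (P : Params F)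

theorem Params.card_firstHubs : P.firstHubs.card = P.k := by
  rw [Params.firstHubs, Fin.card_filter_val_lt, min_eq_right P.k_le_n]

theorem Params.injOn_points (T : Finset (Fin P.n)) :
    Set.InjOn (fun i : Fin P.n => P.x i.succ) T :=
  fun _ _ _ _ h => Fin.succ_injective _ (P.x_injective h)

theorem Params.interp_congr {T : Finset (Fin P.n)} {Y Y' : Fin P.n → P.Vec}
    (h : ∀ i ∈ T, Y i = Y' i) (z : F) : P.interp T Y z = P.interp T Y' z := by
  ext l
  simp only [Params.interp]
  rw [Lagrange.interpolate_eq_of_values_eq_on (r' := fun i => Y' i l)]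
  intro i hi
  rw [h i hi]

/-- The vector of interpolated values depends linearly on the shares. -/
noncomputable def Params.interpLinear (T : Finset (Fin P.n)) (z : F) :
    (Fin P.n → P.Vec) →ₗ[F] P.Vec where
  toFun Y := P.interp T Y z
  map_add' Y Y' := by
    ext l
    simp only [Params.interp, Pi.add_apply, ← Polynomial.eval_add, ← map_add]
    rfl
  map_smul' a Y := by
    ext l
    simp only [Params.interp, Pi.smul_apply, RingHom.id_apply, smul_eq_mul]
    rw [← smul_eq_mul, ← Polynomial.eval_smul, ← map_smul]
    rfl

theorem Params.interp_add (T : Finset (Fin P.n)) (Y Y' : Fin P.n → P.Vec) (z : F) :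
    P.interp T (Y + Y') z = P.interp T Y z + P.interp T Y' z :=
  (P.interpLinear T z).map_add Y Y'

/-- Interpolation recovers polynomials of degree less than the number of points. -/
theorem Params.interp_of_degree_lt {T : Finset (Fin P.n)} {Y : Fin P.n → P.Vec}
    (f : Fin (3 + P.m) → Polynomial F) (hf : ∀ l, (f l).degree < T.card)
    (h : ∀ i ∈ T, ∀ l, Y i l = (f l).eval (P.x i.succ)) (z : F) :
    P.interp T Y z = fun l => (f l).eval z := by
  ext l
  simp only [Params.interp]
  rw [← Lagrange.eq_interpolate_of_eval_eq (f := f l) _ (P.injOn_points T) (hf l)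
    fun i hi => (h i hi l).symm]

/-- Alice's shares lie on polynomials of degree less than `k`, so any `k` of them determine her
vector `u ‖ S`. -/
theorem Params.interp_share (t : Fin P.n → P.Segment) {T : Finset (Fin P.n)} (hT : T.card = P.k) :
    P.interp T (P.share t) (P.x 0) = P.aliceY₀ t := by
  refine P.interp_of_degree_lt (fun l => Lagrange.interpolate P.firstHubs
    (fun i => P.x i.succ) (fun i => (t i).1 l)) (fun l => ?_) (fun i _ l => ?_) _
  · rw [hT, ← P.card_firstHubs]
    exact Lagrange.degree_interpolate_lt _ (P.injOn_points _)
  · rw [Params.share]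
    split_ifs with h
    · rw [Lagrange.eval_interpolate_at_node _ (P.injOn_points _)]
      simpa [Params.firstHubs] using h
    · rfl

/-- The data that hubs other than the first `k` receive from Alice in the `Z`-part of the messages
(it is `0` for the first `k`), with `0` as the default value. -/
def Params.extend (Z : {i : Fin P.n // P.k ≤ i} → P.Vec) (i : Fin P.n) : P.Vec :=
  if h : P.k ≤ i then Z ⟨i, h⟩ else 0

/-- What Alice's pads `R` determine: her vector `u ‖ S`, and the vectors `Z i` for `k ≤ i`. -/
noncomputable def Params.padMap :
    (Fin P.n → P.Vec) →ₗ[F] P.Vec × ({i : Fin P.n // P.k ≤ i} → P.Vec) :=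
  (P.interpLinear P.firstHubs (P.x 0)).prod
    (LinearMap.pi fun i => P.interpLinear P.firstHubs (P.x i.1.succ) - LinearMap.proj i.1)

theorem Params.padMap_pads (t : Fin P.n → P.Segment) :
    P.padMap (fun i => (t i).1) = (P.aliceY₀ t, fun i => P.share t i.1 - (t i.1).1) := by
  refine Prod.ext rfl (funext fun i => ?_)
  have : ¬ (i.1.val < P.k) := not_lt.2 i.2
  simp only [Params.share, this, if_false]
  rfl

variable (C : Finset (Fin P.n))

/-- The pads of the honest hubs, with `0` for the compromised ones. -/
def Params.maskHonest : (Fin P.n → P.Vec) →ₗ[F] (Fin P.n → P.Vec) :=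
  LinearMap.pi fun i => if i ∈ C then 0 else LinearMap.proj i

theorem Params.maskHonest_apply (R : Fin P.n → P.Vec) (i : Fin P.n) :
    P.maskHonest C R i = if i ∈ C then 0 else R i := by
  simp only [Params.maskHonest, LinearMap.pi_apply]
  split_ifs <;> rfl

/-- Secrecy of Shamir's scheme: whatever the pads of fewer than `k` compromised hubs, the pads of
the honest hubs can produce every value of `u ‖ S` and of the vectors `Z i`. -/
theorem Params.surjective_padMap (hC : C.card < P.k) :
    Function.Surjective (P.padMap ∘ₗ P.maskHonest C) := by
  classical
  rintro ⟨y, Z⟩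
  set s : Finset (Fin (P.n + 1)) := insert 0 (C.map (Fin.succEmb P.n)) with hs
  have hcard : s.card ≤ P.k := (Finset.card_insert_le _ _).trans (by simpa using hC)
  -- For each coordinate, a polynomial with the value `y` at `x 0` whose values at the compromised
  -- hubs are those that follow from the pads `0` and from `Z`.
  set f : Fin (3 + P.m) → Polynomial F := fun l =>
    Lagrange.interpolate s P.x (Fin.cases (y l) fun i => P.extend Z i l) with hf
  have hdeg : ∀ l, (f l).degree < P.firstHubs.card := fun l =>
    (Lagrange.degree_interpolate_lt _ P.x_injective.injOn).trans_le
      (by rw [P.card_firstHubs]; exact_mod_cast hcard)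
  have h0 : ∀ l, (f l).eval (P.x 0) = y l := fun l => by
    rw [hf, Lagrange.eval_interpolate_at_node _ P.x_injective.injOn (by simp [hs])]
    rfl
  have hfC : ∀ i ∈ C, ∀ l, (f l).eval (P.x i.succ) = P.extend Z i l := fun i hi l => by
    rw [hf, Lagrange.eval_interpolate_at_node _ P.x_injective.injOn (by simp [hs, hi])]
    rfl
  set R : Fin P.n → P.Vec := fun i l => (f l).eval (P.x i.succ) - P.extend Z i l with hR
  have hmask : P.maskHonest C R = R := by
    ext i l
    rw [P.maskHonest_apply]
    split_ifs with hi
    · simp [hR, hfC i hi]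
    · rfl
  have hint : ∀ z, P.interp P.firstHubs R z = fun l => (f l).eval z := by
    refine P.interp_of_degree_lt f hdeg fun i hi l => ?_
    have : ¬ P.k ≤ i := not_le.2 (by simpa [Params.firstHubs] using hi)
    simp [hR, Params.extend, this]
  refine ⟨R, ?_⟩
  rw [LinearMap.comp_apply, hmask]
  refine Prod.ext ?_ (funext fun i => ?_)
  · exact (hint _).trans (funext h0)
  · change P.interp P.firstHubs R _ - R i.1 = Z i
    rw [hint]
    ext l
    simp [hR, Params.extend, i.2]

/-- Combine the table segments `t` of the compromised hubs with those of the honest hubs, `a`. -/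
def Params.overlay (t a : Fin P.n → P.Segment) (i : Fin P.n) : P.Segment :=
  if i ∈ C then t i else a i

/-- The part of Alice's messages that Eve cannot compute from her own data and from the
secret: the vectors `Z i`, which vanish for `i < k`, the secret-authenticating tag, and the message
tags (those at the places of compromised hubs are not used). -/
abbrev Params.View : Type := ({i : Fin P.n // P.k ≤ i} → P.Vec) × F × (Fin P.n → F)

/-- Alice's message to hub `i`, as given by the view. -/
def Params.viewMsg (v : P.View) (i : Fin P.n) : P.Message where
  A := P.idA
  B := P.idB
  kid := P.kid
  offset := P.offset
  Z := P.extend v.1 i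
  o := v.2.1

/-- Alice's message to hub `i` and its tag, as given by the view and the table segments `t`
of the compromised hubs. -/
def Params.viewSend (t : Fin P.n → P.Segment) (v : P.View) (i : Fin P.n) : P.Tagged :=
  (P.viewMsg v i, if i ∈ C then P.tag (t i) (P.viewMsg v i) else v.2.2 i)

/-- What remains uniform when Alice's secret and messages are known: the first entries of
the tag keys, two of the entries of `u`, and the irrelevant part of the pads. -/
abbrev Params.Hidden : Type :=
  (Fin P.n → F) × (F × F) × LinearMap.ker (P.padMap ∘ₗ P.maskHonest C)

/-- Properties of a parametrization of the table segments `a` of the honest hubs by Alice's secret,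
the view and hidden data, when `t` are the table segments of the compromised hubs. -/
structure Params.IsTableEquiv (t : Fin P.n → P.Segment)
    (e : (Fin P.n → P.Segment) ≃ (Fin P.m → F) × P.View × P.Hidden C) : Prop where
  secret_eq : ∀ a, secret (P.aliceY₀ (P.overlay C t a)) = (e a).1
  send_eq : ∀ a i, P.aliceSend (P.overlay C t a) i = P.viewSend C t (e a).2.1 i
  key_eq : ∀ a i, (a i).2.1 = (e a).2.2.1 i
  tag_eq : ∀ a i,
    (a i).2.2 = (e a).2.1.2.2 i - msgHash (a i).2.1 0 (P.viewMsg (e a).2.1 i).toList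
  aliceY₀_eq : ∀ a, P.aliceY₀ (P.overlay C t a) =
    ofSecretTag (e a).1 (e a).2.1.2.1 (e a).2.2.2.1.1 (e a).2.2.2.1.2
  share_eq : ∀ a i, P.share (P.overlay C t a) i =
    P.extend (e a).2.1.1 i + (P.overlay C t a i).1

theorem Params.share_sub (t : Fin P.n → P.Segment) (i : Fin P.n) :
    P.share t i - (t i).1 = P.extend (fun j => P.share t j - (t j).1) i := by
  rw [Params.extend]
  split_ifs with h
  · rfl
  · simp [Params.share, not_le.1 h]

/-- Alice's secret and messages are jointly uniform, and independent of the hidden data. -/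
theorem Params.exists_isTableEquiv (hC : C.card < P.k) (t : Fin P.n → P.Segment) :
    ∃ e, P.IsTableEquiv C t e := by
  obtain ⟨e₀, he₀⟩ := exists_equiv_prod_ker _ (P.surjective_padMap C hC)
  -- The pads of the compromised hubs shift the linear map by a constant.
  set b := P.padMap (fun i => if i ∈ C then (t i).1 else 0) with hb
  have hpads : ∀ a : Fin P.n → P.Segment,
      (P.aliceY₀ (P.overlay C t a),
        fun i : {i : Fin P.n // P.k ≤ i} =>
          P.share (P.overlay C t a) i - (P.overlay C t a i).1) =
        (e₀ fun i => (a i).1).1 + b := by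
    intro a
    rw [← P.padMap_pads, he₀, hb, LinearMap.comp_apply, ← map_add]
    congr 1
    ext i
    rw [Pi.add_apply, P.maskHonest_apply, Params.overlay]
    split_ifs <;> simp
  -- The inverse: `u ‖ S` is determined by `S`, the tag and two entries of `u`, the pads by
  -- `u ‖ S`, the `Z i` and an element of the kernel, the keys by the tags and their first entries.
  let inv : (Fin P.m → F) × P.View × P.Hidden C → Fin P.n → P.Segment := fun p i =>
    (e₀.symm ((ofSecretTag p.1 p.2.1.2.1 p.2.2.2.1.1 p.2.2.2.1.2, p.2.1.1) - b, p.2.2.2.2) i,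
      p.2.2.1 i, p.2.1.2.2 i - msgHash (p.2.2.1 i) 0 (P.viewMsg p.2.1 i).toList)
  let viewOf : (Fin P.n → P.Segment) → P.View := fun a =>
    (fun i => P.share (P.overlay C t a) i - (P.overlay C t a i).1,
      secretTag (P.aliceY₀ (P.overlay C t a)),
      fun i => P.tag (a i) (P.aliceMsg (P.overlay C t a) i))
  have hmsg : ∀ a i, P.viewMsg (viewOf a) i = P.aliceMsg (P.overlay C t a) i := by
    intro a i
    rw [Params.aliceMsg, P.share_sub]
    rfl
  let fwd : (Fin P.n → P.Segment) → (Fin P.m → F) × P.View × P.Hidden C := fun a =>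
    (secret (P.aliceY₀ (P.overlay C t a)), viewOf a,
      (fun i => (a i).2.1, (P.aliceY₀ (P.overlay C t a) (Fin.castAdd _ 0),
        P.aliceY₀ (P.overlay C t a) (Fin.castAdd _ 2)), (e₀ fun i => (a i).1).2))
  have hleft : Function.LeftInverse inv fwd := by
    intro a
    funext i
    refine Prod.ext ?_ (Prod.ext rfl ?_)
    · have : ((ofSecretTag (fwd a).1 (fwd a).2.1.2.1 (fwd a).2.2.2.1.1 (fwd a).2.2.2.1.2,
          (fwd a).2.1.1) - b, (fwd a).2.2.2.2) = e₀ fun i => (a i).1 := by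
        refine Prod.ext ?_ rfl
        change (ofSecretTag _ _ _ _, _) - b = _
        rw [ofSecretTag_eq_self, sub_eq_iff_eq_add]
        exact hpads a
      change e₀.symm _ i = _
      rw [this, e₀.symm_apply_apply]
    · change P.tag (a i) (P.aliceMsg _ i) - msgHash _ 0 (P.viewMsg (viewOf a) i).toList = _
      rw [hmsg, Params.tag, msgHash_eq_zero_add, add_sub_cancel_right]
  have hright : Function.RightInverse inv fwd := by
    rintro ⟨S, ⟨Z, o, T⟩, ks, ⟨c, e⟩, κ⟩
    set a := inv (S, (Z, o, T), ks, (c, e), κ) with ha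
    have h1 : (e₀ fun i => (a i).1) = ((ofSecretTag S o c e, Z) - b, κ) := by
      rw [ha]
      exact e₀.apply_symm_apply _
    have h2 := hpads a
    rw [h1] at h2
    rw [sub_add_cancel, Prod.mk.injEq] at h2
    have hv : viewOf a = (Z, o, T) := by
      have h3 : (viewOf a).1 = Z := h2.2
      have h4 : (viewOf a).2.1 = o := by
        change secretTag _ = o
        rw [h2.1, secretTag_ofSecretTag]
      have h5 : ∀ i, P.viewMsg (viewOf a) i = P.viewMsg (Z, o, T) i := fun i => by
        simp only [Params.viewMsg, h3, h4]
      refine Prod.ext h3 (Prod.ext h4 (funext fun i => ?_))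
      change P.tag (a i) (P.aliceMsg _ i) = T i
      rw [← hmsg, h5, Params.tag, msgHash_eq_zero_add]
      change T i - msgHash (ks i) 0 _ + msgHash (ks i) 0 _ = T i
      rw [sub_add_cancel]
    refine Prod.ext ?_ (Prod.ext hv (Prod.ext rfl (Prod.ext (Prod.ext ?_ ?_) ?_)))
    · change secret (P.aliceY₀ _) = S
      rw [h2.1, secret_ofSecretTag]
    · change P.aliceY₀ _ _ = c
      rw [h2.1, ofSecretTag_zero]
    · change P.aliceY₀ _ _ = e
      rw [h2.1, ofSecretTag_two]
    · change (e₀ fun i => (a i).1).2 = κ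
      rw [h1]
  refine ⟨⟨fwd, inv, hleft, hright⟩, fun a => rfl, fun a i => ?_, fun a i => rfl, fun a i => ?_,
    fun a => ?_, fun a i => ?_⟩
  · change _ = P.viewSend C t (viewOf a) i
    rw [Params.viewSend, Params.aliceSend, hmsg]
    refine Prod.ext rfl ?_
    change P.tag (P.overlay C t a i) _ = _
    rw [Params.overlay]
    split_ifs <;> rfl
  · exact (congrArg (fun g : Fin P.n → P.Segment => (g i).2.2) (hleft a)).symm
  · exact (ofSecretTag_eq_self _).symm
  · rw [← sub_eq_iff_eq_add, P.share_sub]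
    rfl

theorem Params.overlay_update {t a : Fin P.n → P.Segment} {i : Fin P.n} (hi : i ∈ C)
    (g : P.Segment) : P.overlay C (Function.update t i g) a =
      Function.update (P.overlay C t a) i g := by
  funext j
  by_cases hj : j = i
  · subst hj
    simp [Params.overlay, hi]
  · simp [Params.overlay, hj]

/-- A choice of the parametrization of Alice's table segments. -/
noncomputable def Params.tableEquiv {P : Params F} {C : Finset (Fin P.n)} (hC : C.card < P.k) (t : Fin P.n → P.Segment) :
    (Fin P.n → P.Segment) ≃ (Fin P.m → F) × P.View × P.Hidden C :=
  (P.exists_isTableEquiv C hC t).choose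

theorem Params.isTableEquiv {P : Params F} {C : Finset (Fin P.n)} (hC : C.card < P.k) (t : Fin P.n → P.Segment) :
    P.IsTableEquiv C t (P.tableEquiv hC t) :=
  (P.exists_isTableEquiv C hC t).choose_spec

end Alice

section Probabilities

variable {F : Type} [Field F] [Fintype F] (P : Params F)

/-- The probability to forge a message tag. -/
noncomputable def Params.forgeProb : ENNReal := (P.s : ENNReal) / Fintype.card F

/-- The probability that a wrong candidate passes the secret validation. -/
noncomputable def Params.secretForgeProb : ENNReal := ((P.m + 1 : ℕ) : ENNReal) / Fintype.card F

theorem mul_card_div_card_prod {F : Type} [Field F] [Fintype F] (N : ℕ) :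
    ((N * Fintype.card F : ℕ) : ENNReal) / Fintype.card (F × F) = N / Fintype.card F := by
  rw [Fintype.card_prod]
  push_cast
  exact ENNReal.mul_div_mul_right _ _ (by simp) (by simp)

theorem Params.one_le_s : 1 ≤ P.s := by
  rw [Params.s]
  omega

theorem Params.ncard_fresh_le (M : P.Tagged) :
    {v : F × F | M.2 = msgHash v.1 v.2 M.1.toList}.ncard ≤ P.s * Fintype.card F :=
  (ncard_msgHash_eq_le _ _).trans (Nat.le_mul_of_pos_left _ P.one_le_s)

theorem Params.ncard_forge_le {M M' : P.Tagged} (h : M ≠ M') :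
    {v : F × F | M'.2 = msgHash v.1 (M.2 - msgHash v.1 0 M.1.toList) M'.1.toList}.ncard ≤
      P.s * Fintype.card F := by
  refine ncard_msgHash_forge_le (P.length_toList _) (P.length_toList _) fun h' => h ?_
  rw [Prod.mk.injEq] at h'
  exact Prod.ext (Msg.toList_injective h'.1.symm) h'.2.symm

theorem Params.forgeProb_ne_top : P.forgeProb ≠ ⊤ :=
  ENNReal.div_ne_top (by simp) (by simp)

theorem Params.secretForgeProb_ne_top : P.secretForgeProb ≠ ⊤ :=
  ENNReal.div_ne_top (by simp) (by simp)

/-- A bound for the probability that Bob's result differs from that of the ideal resource. -/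
noncomputable def Params.bobCost : ENNReal :=
  P.n.choose P.k * P.secretForgeProb + P.n * P.forgeProb

theorem Params.bobCost_ne_top : P.bobCost ≠ ⊤ :=
  ENNReal.add_ne_top.2 ⟨ENNReal.mul_ne_top (by simp) P.secretForgeProb_ne_top,
    ENNReal.mul_ne_top (by simp) P.forgeProb_ne_top⟩

end Probabilities

end DSKE

/-! ### The simulator -/

namespace DSKE

section Simulator

variable {F : Type} [Field F] [Fintype F] [DecidableEq F] (P : Params F) (C : Finset (Fin P.n))

/-- The state of the simulator. -/
structure Params.SimState where
  /-- the table segments of the compromised hubs with Alice -/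
  tA : Fin P.n → P.Segment
  /-- the table segments of the compromised hubs with Bob -/
  tB : Fin P.n → P.Segment
  /-- what each hub has received -/
  atHub : Fin P.n → List P.Tagged
  /-- what each hub has sent to Bob -/
  fromHub : Fin P.n → Option P.Tagged
  /-- what Bob has received in the name of each hub -/
  atBob : Fin P.n → List P.Tagged
  /-- whether a hub has used its segment -/
  used : Fin P.n → Bool
  /-- once Alice's start has been noticed: the table segments of the compromised hubs that she has
  used, and the simulated part of her messages -/
  begun : Option ((Fin P.n → P.Segment) × P.View)

variable {P}

/-- The simulated messages of Alice. -/
def Params.SimState.fromAlice (s : P.SimState) (i : Fin P.n) : Option P.Tagged :=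
  s.begun.map fun p => P.viewSend C p.1 p.2 i

open Classical in
/-- The message that Bob accepts in the name of hub `i`, under the assumption that he accepts from
an honest hub only what it has sent. -/
noncomputable def Params.SimState.accepted (s : P.SimState) (i : Fin P.n) : Option P.Message :=
  if i ∈ C then P.accepted (s.tB i) (s.atBob i)
  else match P.first (s.atBob i) with
    | none => none
    | some M => if s.fromHub i = some M then some M.1 else none

/-- The deviation of the share that Bob obtains from hub `i` from Alice's share. -/
noncomputable def Params.SimState.deviation (s : P.SimState) (t : Fin P.n → P.Segment) (v : P.View)
    (i : Fin P.n) : P.Vec :=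
  if i ∈ C then
    match s.accepted C i with
    | none => 0
    | some M => P.decrypt (s.tB i) M - (P.extend v.1 i + (t i).1)
  else 0

/-- Some set of `k` accepted messages leads to Alice's vector `u ‖ S`, because the deviations of
the shares cancel. -/
def Params.SimState.Good (s : P.SimState) : Prop :=
  ∃ t v, s.begun = some (t, v) ∧ ∃ T : Finset (Fin P.n), T.card = P.k ∧
    (∀ i ∈ T, ∃ M, s.accepted C i = some M ∧ M.kid = P.kid ∧ M.o = v.2.1) ∧
    P.interp T (s.deviation C t v) (P.x 0) = 0

open Classical in
/-- The position of the switch of the ideal resource. -/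
noncomputable def Params.SimState.good (s : P.SimState) : Bool := decide (s.Good C)

/-- If Alice has started since the last activation, sample the simulated part of her messages. -/
noncomputable def Params.SimState.notice (s : P.SimState) (started : Bool) : PMF P.SimState :=
  if started = true ∧ s.begun = none then
    (PMF.uniformOfFintype P.View).map fun v => { s with begun := some (s.tA, v) }
  else PMF.pure s

/-- The simulated message of an honest hub to Bob. -/
def Params.simHubMsg (M : P.Message) (Z : P.Vec) : P.Message where
  A := M.A
  B := M.B
  kid := M.kid
  offset := P.offset
  Z := Z
  o := M.o

open Classical in
/-- The simulated reaction to a query of Eve. An honest hub rejects whatever differs from what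
Alice has sent to it; what it sends to Bob is random. -/
noncomputable def Params.SimState.react (s : P.SimState) :
    (q : (P.realEve C).Q) → PMF ((P.realEve C).R q × P.SimState)
  | .inl (.seeAlice i) => PMF.pure (s.fromAlice C i, s)
  | .inl (.seeHub i) => PMF.pure (s.fromHub i, s)
  | .inl (.toHub i M) =>
    PMF.pure ((), { s with atHub := Function.update s.atHub i (s.atHub i ++ [M]) })
  | .inl (.toBob i M) =>
    PMF.pure ((), { s with atBob := Function.update s.atBob i (s.atBob i ++ [M]) })
  | .inl (.setTableA i t) => PMF.pure ((), { s with tA := Function.update s.tA i t })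
  | .inl (.setTableB i t) => PMF.pure ((), { s with tB := Function.update s.tB i t })
  | .inr i =>
    if s.used i then PMF.pure ((), s)
    else match P.first (s.atHub i) with
      | none => PMF.pure ((), s)
      | some M =>
        if s.fromAlice C i = some M then
          (PMF.uniformOfFintype (P.Vec × F)).map fun z =>
            ((), { s with
              fromHub := Function.update s.fromHub i (some (P.simHubMsg M.1 z.1, z.2))
              used := Function.update s.used i true })
        else PMF.pure ((), { s with used := Function.update s.used i true })

variable (P)

/-- The initial state of the simulator. -/
def Params.simStart : P.SimState where
  tA _ := 0
  tB _ := 0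
  atHub _ := []
  fromHub _ := none
  atBob _ := []
  used _ := false
  begun := none

/-- The simulator: it asks whether Alice has started, samples her messages if this is new, reacts,
and sets the switch. -/
noncomputable def Params.simulator : Converter (P.realEve C) idealEve where
  State := P.SimState
  start := P.simStart
  step s q :=
    .query .started fun (b : Bool) =>
    .sample P.SimState (s.notice b) fun s₁ =>
    .sample ((P.realEve C).R q × P.SimState) (s₁.react C q) fun r =>
    .query (.setSwitch (r.2.good C)) fun _ =>
    .ret (r.1, r.2)

/-- The joint interface of Alice, Bob and Eve in the real system. -/
abbrev Params.outer : Interface :=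
  Interface.joint (tri P.aliceUser P.bobUser (P.realEve C))

/-- The step of the ideal resource with the simulator, on the pairs of their states. -/
noncomputable def Params.simStep (l : P.IdealState × P.SimState) :
    (q : (P.outer C).Q) → PMF ((P.outer C).R q × P.IdealState × P.SimState)
  | ⟨.alice, _⟩ => PMF.pure ((P.kid, l.1.S), { l.1 with started := true }, l.2)
  | ⟨.bob, _⟩ => PMF.pure (P.idealBob l.1, { l.1 with bob := some (P.idealBob l.1) }, l.2)
  | ⟨.eve, q⟩ => (l.2.notice l.1.started).bind fun s₁ => (s₁.react C q).map fun r =>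
      (r.1, { l.1 with switch := r.2.good C }, r.2)

/-- The step of the system in which the secret is sampled only when Alice starts. -/
noncomputable def Params.lazyStep (l : P.IdealState × P.SimState) :
    (q : (P.outer C).Q) → PMF ((P.outer C).R q × P.IdealState × P.SimState)
  | ⟨.alice, _⟩ =>
    if l.1.started then PMF.pure ((P.kid, l.1.S), l)
    else (PMF.uniformOfFintype (Fin P.m → F)).map fun S =>
      ((P.kid, S), { l.1 with S := S, started := true }, l.2)
  | ⟨.bob, q⟩ => P.simStep C l ⟨.bob, q⟩
  | ⟨.eve, q⟩ => P.simStep C l ⟨.eve, q⟩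

/-- The states of the converters that are attached to the ideal resource. -/
def Params.simConv (s : P.SimState) :
    (i : Side) → (simulate (A := P.aliceUser) (B := P.bobUser) (P.simulator C) i).State
  | .alice => ()
  | .bob => ()
  | .eve => s

/-- The state of the ideal resource with the simulator, from the pair of their states. -/
def Params.simJoin (l : P.IdealState × P.SimState) :
    (P.ideal.attach (simulate (P.simulator C))).State :=
  (l.1, P.simConv C l.2)

theorem Params.attach_simulate_step (l : P.IdealState × P.SimState) (q : (P.outer C).Q) :
    (P.ideal.attach (simulate (P.simulator C))).step (P.simJoin C l) q =
      (P.simStep C l q).map fun r => (r.1, P.simJoin C r.2) := by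
  have upd : ∀ (i : Side) (s' : P.SimState), (i ≠ .eve → s' = l.2) →
      Function.update (P.simConv C l.2) i (P.simConv C s' i) = P.simConv C s' := by
    intro i s' h
    funext j
    cases i <;> cases j <;> first | rfl | (rw [h (by simp)]; rfl)
  rcases q with ⟨_ | _ | _, q⟩
  · rw [Params.simStep, PMF.pure_map]
    refine Resource.attach_step_pure (x := ()) ?_ (upd .alice l.2 fun _ => rfl)
    exact PMF.pure_bind ((P.kid, l.1.S), ({ l.1 with started := true } : P.IdealState))
      fun r => PMF.pure ((r.1, ()), r.2)
  · rw [Params.simStep, PMF.pure_map]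
    refine Resource.attach_step_pure (x := ()) ?_ (upd .bob l.2 fun _ => rfl)
    exact PMF.pure_bind
      (P.idealBob l.1, ({ l.1 with bob := some (P.idealBob l.1) } : P.IdealState))
      fun r => PMF.pure ((r.1, ()), r.2)
  · have hrun : ((P.simulator C).step l.2 q).run (I := idealEve)
        (fun t (q' : idealEve.Q) => P.ideal.step t ⟨.eve, q'⟩) l.1 =
        (P.simStep C l ⟨.eve, q⟩).map fun r => ((r.1, r.2.2), r.2.1) := by
      rw [Params.simStep, PMF.map_bind]
      refine (PMF.pure_bind (l.1.started, l.1) _).trans ?_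
      refine congrArg (PMF.bind (l.2.notice l.1.started)) (funext fun s₁ => ?_)
      rw [PMF.map_comp, ← PMF.bind_pure_comp]
      refine congrArg (PMF.bind (s₁.react C q)) (funext fun r => ?_)
      exact PMF.pure_bind ((), { l.1 with switch := r.2.good C }) _
    exact Resource.attach_step_eq (R := P.ideal) (π := simulate (P.simulator C))
      (σ := P.simConv C l.2) (i := .eve) hrun fun r =>
        congrArg (fun z => (r.1, r.2.1, z)) (upd .eve r.2.2 fun h => absurd rfl h)

/-- The distribution of the state of the ideal resource, given the state of the lazy system: before
Alice starts, the secret is uniform. -/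
noncomputable def Params.eager (l : P.IdealState × P.SimState) :
    PMF (P.ideal.attach (simulate (P.simulator C))).State :=
  if l.1.started then PMF.pure (P.simJoin C l)
  else (PMF.uniformOfFintype (Fin P.m → F)).map fun S => P.simJoin C ({ l.1 with S := S }, l.2)

/-- As long as Alice has not started, the secret is not used, so it may be sampled at her start. -/
theorem Params.eager_step (l : P.IdealState × P.SimState) (q : (P.outer C).Q) :
    ((P.eager C l).bind fun s => (P.ideal.attach (simulate (P.simulator C))).step s q) =
      (P.lazyStep C l q).bind fun r => (P.eager C r.2).map (Prod.mk r.1) := by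
  obtain ⟨⟨S, st, sw, bob⟩, s⟩ := l
  cases st
  · simp only [Params.eager, Bool.false_eq_true, if_false, PMF.bind_map, Function.comp_def,
      P.attach_simulate_step]
    rcases q with ⟨_ | _ | _, q⟩
    · simp only [Params.simStep, Params.lazyStep, PMF.pure_map, Bool.false_eq_true, if_false,
        PMF.bind_map, Function.comp_def, if_true]
    · have hb : ∀ S', P.idealBob ⟨S', false, sw, bob⟩ = P.idealBob ⟨S, false, sw, bob⟩ :=
        fun S' => by cases bob <;> rfl
      simp only [Params.simStep, Params.lazyStep, PMF.pure_map, Bool.false_eq_true, if_false,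
        PMF.pure_bind, hb, PMF.map_comp]
      rfl
    · have hn : s.notice false = PMF.pure s := by simp [Params.SimState.notice]
      simp only [Params.simStep, Params.lazyStep, hn, PMF.pure_bind, PMF.map_comp, PMF.bind_map,
        Bool.false_eq_true, if_false, Function.comp_def]
      simp only [← PMF.bind_pure_comp, Function.comp_def]
      rw [PMF.bind_comm]
  · simp only [Params.eager, if_true, PMF.pure_bind, P.attach_simulate_step]
    rcases q with ⟨_ | _ | _, q⟩
    · simp [Params.simStep, Params.lazyStep, PMF.pure_map]
    · simp [Params.simStep, Params.lazyStep, PMF.pure_map]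
    · simp only [Params.simStep, Params.lazyStep, PMF.map_bind, PMF.map_comp, PMF.bind_bind,
        PMF.bind_map, if_true, Function.comp_def, PMF.pure_map]
      rfl

end Simulator

end DSKE

/-! ### The steps of the real system -/

namespace DSKE

section Real

variable {F : Type} [Field F] [Fintype F] [DecidableEq F] (P : Params F) (C : Finset (Fin P.n))

/-- The states of the converters of the protocol. -/
def Params.realConv (al : Option P.Result) (used : Fin P.n → Bool)
    (bob : Option (Option P.Result)) : (p : P.Party C) → (P.protocol C p).State
  | .alice => al
  | .bob => bob
  | .hub i => used i
  | .eve => ()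

/-- The state of the real system: the state of the network, the result of Alice, the hubs that have
used their segments, and the result of Bob. -/
def Params.realJoin (net : P.NetState) (al : Option P.Result) (used : Fin P.n → Bool)
    (bob : Option (Option P.Result)) : (P.real C).State :=
  (net, P.realConv C al used bob)

variable {P C}

theorem Params.update_realConv_alice (al al' : Option P.Result) (used : Fin P.n → Bool)
    (bob : Option (Option P.Result)) :
    Function.update (P.realConv C al used bob) .alice al' = P.realConv C al' used bob := by
  funext p
  cases p <;> rfl

theorem Params.update_realConv_bob (al : Option P.Result) (used : Fin P.n → Bool)
    (bob bob' : Option (Option P.Result)) :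
    Function.update (P.realConv C al used bob) .bob bob' = P.realConv C al used bob' := by
  funext p
  cases p <;> rfl

theorem Params.update_realConv_eve (al : Option P.Result) (used : Fin P.n → Bool)
    (bob : Option (Option P.Result)) :
    Function.update (P.realConv C al used bob) .eve () = P.realConv C al used bob := by
  funext p
  cases p <;> rfl

theorem Params.update_realConv_hub (al : Option P.Result) (used : Fin P.n → Bool)
    (bob : Option (Option P.Result)) (i : {i : Fin P.n // i ∉ C}) (b : Bool) :
    Function.update (P.realConv C al used bob) (.hub i) b =
      P.realConv C al (Function.update used i b) bob := by
  funext p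
  cases p with
  | hub j =>
    change _ = Function.update used i b j
    by_cases h : j = i
    · subst h
      rw [Function.update_self]
      exact Function.update_self _ _ _
    · rw [Function.update_of_ne fun h' => h (Subtype.ext h')]
      exact Function.update_of_ne (fun h' => h (Params.Party.hub.inj h')) _ _
  | _ => rfl

theorem Params.real_step_of_attach {s s' : (P.real C).State} {q : (P.outer C).Q}
    {y : (Interface.joint (P.user C)).R (P.route C q)}
    (h : ((P.network C).attach (P.protocol C)).step s (P.route C q) = PMF.pure (y, s')) :
    (P.real C).step s q = PMF.pure (P.routeBack C q y, s') :=
  (congrArg (PMF.map _) h).trans (PMF.pure_map _ _)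

variable (net : P.NetState) (al : Option P.Result) (used : Fin P.n → Bool)
  (bob : Option (Option P.Result))

theorem Params.real_step_alice_some (r : P.Result) (q : Unit) :
    (P.real C).step (P.realJoin C net (some r) used bob) ⟨.alice, q⟩ =
      PMF.pure (r, P.realJoin C net (some r) used bob) := by
  refine Params.real_step_of_attach (q := ⟨.alice, q⟩) (y := r) ?_
  exact Resource.attach_step_pure (i := Params.Party.alice) (x := some r) rfl
    (Params.update_realConv_alice _ _ _ _)

theorem Params.real_step_alice_none (q : Unit) :
    (P.real C).step (P.realJoin C net none used bob) ⟨.alice, q⟩ =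
      PMF.pure ((P.kid, secret (P.aliceY₀ net.tA)),
        P.realJoin C { net with fromAlice := fun i => some (P.aliceSend net.tA i) }
          (some (P.kid, secret (P.aliceY₀ net.tA))) used bob) := by
  refine Params.real_step_of_attach (q := ⟨.alice, q⟩)
    (y := (P.kid, secret (P.aliceY₀ net.tA))) ?_
  refine Resource.attach_step_pure (i := Params.Party.alice)
    (x := some (P.kid, secret (P.aliceY₀ net.tA))) ?_ (Params.update_realConv_alice _ _ _ _)
  refine (PMF.pure_bind (net.tA, net) _).trans ?_
  exact PMF.pure_bind
    ((), ({ net with fromAlice := fun i => some (P.aliceSend net.tA i) } : P.NetState)) _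

theorem Params.real_step_bob_some (r : Option P.Result) (q : Unit) :
    (P.real C).step (P.realJoin C net al used (some r)) ⟨.bob, q⟩ =
      PMF.pure (r, P.realJoin C net al used (some r)) := by
  refine Params.real_step_of_attach (q := ⟨.bob, q⟩) (y := r) ?_
  exact Resource.attach_step_pure (i := Params.Party.bob) (x := some r) rfl
    (Params.update_realConv_bob _ _ _ _)

theorem Params.real_step_bob_none (q : Unit) :
    (P.real C).step (P.realJoin C net al used none) ⟨.bob, q⟩ =
      PMF.pure (P.bobResult net.tB net.atBob,
        P.realJoin C net al used (some (P.bobResult net.tB net.atBob))) := by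
  refine Params.real_step_of_attach (q := ⟨.bob, q⟩) (y := P.bobResult net.tB net.atBob) ?_
  refine Resource.attach_step_pure (i := Params.Party.bob)
    (x := some (P.bobResult net.tB net.atBob)) ?_ (Params.update_realConv_bob _ _ _ _)
  refine (PMF.pure_bind (net.tB, net) _).trans ?_
  exact PMF.pure_bind (net.atBob, net) _

theorem Params.real_step_eve (q : P.EveQuery C) :
    (P.real C).step (P.realJoin C net al used bob) ⟨.eve, .inl q⟩ =
      PMF.pure ((P.netStep C net ⟨.eve, q⟩).1,
        P.realJoin C (P.netStep C net ⟨.eve, q⟩).2 al used bob) := by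
  refine Params.real_step_of_attach (q := ⟨.eve, .inl q⟩) (y := (P.netStep C net ⟨.eve, q⟩).1) ?_
  refine Resource.attach_step_pure (i := Params.Party.eve) (x := ()) ?_
    (Params.update_realConv_eve _ _ _)
  exact PMF.pure_bind (P.netStep C net ⟨.eve, q⟩) _

/-- The effect of the activation of a hub: the new state of the network, and whether it has used its
segment. -/
def Params.hubActivate (i : Fin P.n) : P.NetState × Bool :=
  if used i then (net, true)
  else match P.first (net.atHub i) with
    | none => (net, false)
    | some M =>
      if P.validTag (net.tA i) M then
        ({ net with
          fromHub := Function.update net.fromHub i (some (P.hubSend (net.tA i) (net.tB i) M.1)) },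
          true)
      else (net, true)

theorem Params.real_step_hub (i : {i : Fin P.n // i ∉ C}) :
    (P.real C).step (P.realJoin C net al used bob) ⟨.eve, .inr i⟩ =
      PMF.pure ((), P.realJoin C (Params.hubActivate net used i).1 al
        (Function.update used i (Params.hubActivate net used i).2) bob) := by
  refine Params.real_step_of_attach (q := ⟨.eve, .inr i⟩) (y := ()) ?_
  refine Resource.attach_step_pure (i := Params.Party.hub i)
    (x := (Params.hubActivate net used i).2) ?_ (Params.update_realConv_hub _ _ _ _ _)
  change (P.hubConverter.step (used i) ()).run
    (fun t (q' : P.hubNet.Q) => (P.network C).step t ⟨.hub i, q'⟩) net = _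
  rw [Params.hubActivate]
  cases used i
  · rw [if_neg Bool.false_ne_true]
    refine (PMF.pure_bind (net.atHub i, net) _).trans ?_
    change Prog.run _ (match P.first (net.atHub i) with | none => _ | some M => _) net = _
    cases P.first (net.atHub i) with
    | none => rfl
    | some M =>
      refine (PMF.pure_bind ((net.tA i, net.tB i), net) _).trans ?_
      change Prog.run _ (if P.validTag (net.tA i) M then _ else _) net =
        (fun h : P.NetState × Bool => PMF.pure (((), h.2), h.1))
          (if P.validTag (net.tA i) M then _ else _)
      by_cases hv : P.validTag (net.tA i) M
      · rw [if_pos hv]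
        refine (congrArg (fun p => Prog.run _ p net) (if_pos hv)).trans ?_
        exact PMF.pure_bind ((), ({ net with
          fromHub := Function.update net.fromHub i
            (some (P.hubSend (net.tA i) (net.tB i) M.1)) } : P.NetState)) _
      · rw [if_neg hv]
        exact congrArg (fun p => Prog.run _ p net) (if_neg hv)
  · rfl

end Real

end DSKE

/-! ### The real system, conditioned on what has been observed -/

namespace DSKE

section Views

variable {F : Type} [Field F] [Fintype F] {P : Params F} {C : Finset (Fin P.n)}

/-- The table segments that the compromised hubs have shared with Alice, as she uses them. -/
def Params.SimState.tablesA (s : P.SimState) : Fin P.n → P.Segment :=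
  match s.begun with
  | none => s.tA
  | some p => p.1

/-- The table segments of the honest hubs with Alice, when the observations are as in `l`: what has
been observed is inserted into uniform segments `a`. -/
noncomputable def Params.honestA (hC : C.card < P.k) (l : P.IdealState × P.SimState)
    (a : Fin P.n → P.Segment) : Fin P.n → P.Segment :=
  if l.1.started then
    match l.2.begun with
    | none => (P.tableEquiv hC l.2.tA).symm (l.1.S, (P.tableEquiv hC l.2.tA a).2)
    | some p => (P.tableEquiv hC p.1).symm (l.1.S, p.2, (P.tableEquiv hC p.1 a).2.2)
  else a

/-- The table segment of an honest hub with Bob, if the hub has the share `Y`: the message that it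
has sent is inserted into a uniform segment `g`. -/
def Params.honestB (M : Option P.Tagged) (Y : P.Vec) (g : P.Segment) : P.Segment :=
  match M with
  | none => g
  | some M => (Y - M.1.Z, g.2.1, M.2 - msgHash g.2.1 0 M.1.toList)

/-- The share of an honest hub with the table segment `g`. -/
def Params.SimState.shareOf (s : P.SimState) (i : Fin P.n) (g : P.Segment) : P.Vec :=
  match s.begun with
  | none => 0
  | some p => P.extend p.2.1 i + g.1

variable (C) in
/-- The state of the network, from the observations and the table segments `a` and `b` of the
honest hubs (the latter, before the insertion of what has been observed). -/
noncomputable def Params.reconNet (l : P.IdealState × P.SimState) (a b : Fin P.n → P.Segment) :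
    P.NetState where
  tA := P.overlay C l.2.tA a
  tB := P.overlay C l.2.tB fun i => Params.honestB (l.2.fromHub i) (l.2.shareOf i (a i)) (b i)
  fromAlice i := if l.1.started then some (P.aliceSend (P.overlay C l.2.tablesA a) i) else none
  atHub := l.2.atHub
  fromHub := l.2.fromHub
  atBob := l.2.atBob

theorem Params.reconNet_tB_of_notMem {l : P.IdealState × P.SimState} {a b : Fin P.n → P.Segment}
    {i : Fin P.n} (hi : i ∉ C) : (Params.reconNet C l a b).tB i =
      Params.honestB (l.2.fromHub i) (l.2.shareOf i (a i)) (b i) := by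
  simp [Params.reconNet, Params.overlay, hi]

theorem Params.reconNet_tB_of_mem {l : P.IdealState × P.SimState} {a b : Fin P.n → P.Segment}
    {i : Fin P.n} (hi : i ∈ C) : (Params.reconNet C l a b).tB i = l.2.tB i := by
  simp [Params.reconNet, Params.overlay, hi]

variable (P) in
/-- Consistency of the observations. -/
structure Params.Consistent (l : P.IdealState × P.SimState) : Prop where
  started_of_begun : l.2.begun ≠ none → l.1.started = true
  begun_of_fromHub : ∀ i M, l.2.fromHub i = some M →
    ∃ p, l.2.begun = some p ∧ M.1.kid = P.kid ∧ M.1.o = p.2.2.1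
  used_of_fromHub : ∀ i, l.2.used i = false → l.2.fromHub i = none

/-- After the insertion, the table segments of the honest hubs agree with the observed messages of
Alice. -/
theorem Params.tableEquiv_honestA {hC : C.card < P.k} {l : P.IdealState × P.SimState}
    (hl : P.Consistent l) {p} (hp : l.2.begun = some p) (a : Fin P.n → P.Segment) :
    P.tableEquiv hC p.1 (P.honestA hC l a) = (l.1.S, p.2, (P.tableEquiv hC p.1 a).2.2) := by
  have : l.1.started = true := hl.started_of_begun (by simp [hp])
  simp [Params.honestA, this, hp]

variable [DecidableEq F]

variable (C) in
/-- The state of the real system, from the observations and the table segments of the honest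
hubs. -/
noncomputable def Params.reconOf (l : P.IdealState × P.SimState) (a b : Fin P.n → P.Segment) :
    (P.real C).State :=
  P.realJoin C (Params.reconNet C l a b) (if l.1.started then some (P.kid, l.1.S) else none)
    l.2.used l.1.bob

/-- The state of the real system, from the observations and uniform data. -/
noncomputable def Params.recon (hC : C.card < P.k) (l : P.IdealState × P.SimState)
    (w : (Fin P.n → P.Segment) × (Fin P.n → P.Segment)) : (P.real C).State :=
  Params.reconOf C l (P.honestA hC l w.1) w.2

variable (P) in
/-- The uniform distribution of all table segments. -/
noncomputable abbrev Params.uniformTables :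
    PMF ((Fin P.n → P.Segment) × (Fin P.n → P.Segment)) :=
  PMF.uniformOfFintype _

/-- The distribution of the state of the real system, given the observations. -/
noncomputable def Params.posterior (hC : C.card < P.k) (l : P.IdealState × P.SimState) :
    PMF (P.real C).State :=
  P.uniformTables.map (P.recon hC l)

theorem Params.bind_step_approx {hC : C.card < P.k} {l l' : P.IdealState × P.SimState}
    {q : (P.outer C).Q} {y : (P.outer C).R q}
    {f : (Fin P.n → P.Segment) × (Fin P.n → P.Segment) → (P.outer C).R q × (P.real C).State}
    (bad : Set ((Fin P.n → P.Segment) × (Fin P.n → P.Segment)))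
    (h : ∀ w, (P.real C).step (P.recon hC l w) q = PMF.pure (f w))
    (hf : ∀ w, w ∉ bad → f w = (y, P.recon hC l' w)) :
    PMF.ApproxLE (P.uniformTables.toOuterMeasure bad)
      ((P.posterior hC l).bind fun s => (P.real C).step s q)
      ((P.posterior hC l').map (Prod.mk y)) := by
  have h1 : ((P.posterior hC l).bind fun s => (P.real C).step s q) = P.uniformTables.map f := by
    rw [Params.posterior, PMF.bind_map, ← PMF.bind_pure_comp]
    exact congrArg (PMF.bind _) (funext h)
  rw [h1, Params.posterior, PMF.map_comp]
  exact PMF.ApproxLE.map_of_eqOn _ bad hf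

theorem Params.bind_step_eq {hC : C.card < P.k} {l l' : P.IdealState × P.SimState}
    {q : (P.outer C).Q} {y : (P.outer C).R q}
    (h : ∀ w, (P.real C).step (P.recon hC l w) q = PMF.pure (y, P.recon hC l' w)) :
    ((P.posterior hC l).bind fun s => (P.real C).step s q) =
      (P.posterior hC l').map (Prod.mk y) := by
  rw [Params.posterior, PMF.bind_map, Params.posterior, PMF.map_comp, ← PMF.bind_pure_comp]
  exact congrArg (PMF.bind _) (funext h)

theorem Params.bisim_alice_started {hC : C.card < P.k} {l : P.IdealState × P.SimState}
    (hst : l.1.started = true) (q : Unit) :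
    ((P.posterior hC l).bind fun s => (P.real C).step s ⟨.alice, q⟩) =
      (P.posterior hC l).map (Prod.mk ((P.kid, l.1.S) : P.Result)) := by
  refine Params.bind_step_eq (q := ⟨.alice, q⟩) (y := (P.kid, l.1.S)) fun w => ?_
  simp only [Params.recon, Params.reconOf, hst, if_true]
  exact Params.real_step_alice_some _ _ _ _ _

/-- When Alice starts, her secret is uniform and independent of what has been observed. -/
theorem Params.bisim_alice_start {hC : C.card < P.k} {l : P.IdealState × P.SimState}
    (hl : P.Consistent l) (hst : l.1.started = false) (q : Unit) :
    ((P.posterior hC l).bind fun s => (P.real C).step s ⟨.alice, q⟩) =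
      (PMF.uniformOfFintype (Fin P.m → F)).bind fun S =>
        (P.posterior hC ({ l.1 with S := S, started := true }, l.2)).map
          (Prod.mk ((P.kid, S) : P.Result)) := by
  have hb : l.2.begun = none := by
    by_contra h
    simp [hl.started_of_begun h] at hst
  have hstep : ∀ w, (P.real C).step (P.recon hC l w) ⟨.alice, q⟩ =
      PMF.pure ((P.kid, secret (P.aliceY₀ (P.overlay C l.2.tA w.1))),
        Params.reconOf C ({ l.1 with
          S := secret (P.aliceY₀ (P.overlay C l.2.tA w.1)), started := true }, l.2) w.1 w.2) := by
    intro w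
    simp only [Params.recon, Params.reconOf, Params.honestA, hst, Bool.false_eq_true, if_false,
      if_true]
    refine (Params.real_step_alice_none _ _ _ _).trans ?_
    simp only [Params.reconNet, Params.SimState.tablesA, hb, if_true]
    rfl
  rw [Params.posterior, PMF.bind_map]
  refine (congrArg (PMF.bind _) (funext hstep)).trans ?_
  rw [Params.uniformTables, PMF.uniformOfFintype_resample_fst (P.tableEquiv hC l.2.tA)]
  refine (PMF.bind_bind _ _ _).trans ?_
  refine congrArg (PMF.bind _) (funext fun S => ?_)
  refine (PMF.bind_map _ _ _).trans ?_
  rw [Params.posterior, PMF.map_comp, ← PMF.bind_pure_comp]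
  refine congrArg (PMF.bind _) (funext fun w => ?_)
  have hS : secret (P.aliceY₀ (P.overlay C l.2.tA
      ((P.tableEquiv hC l.2.tA).symm (S, (P.tableEquiv hC l.2.tA w.1).2)))) = S := by
    rw [(P.isTableEquiv hC l.2.tA).secret_eq, Equiv.apply_symm_apply]
  simp only [Function.comp, hS, Params.recon, Params.honestA, hb, if_true]
  rfl

/-- Sampling Alice's messages later, independently of her secret, does not change the distribution of
the state of the real system. -/
theorem Params.bisim_notice {hC : C.card < P.k} {l : P.IdealState × P.SimState}
    (hl : P.Consistent l) :
    P.posterior hC l =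
      (l.2.notice l.1.started).bind fun s => P.posterior hC (l.1, s) := by
  rw [Params.SimState.notice]
  split_ifs with h
  · obtain ⟨hst, hb⟩ := h
    have hfrom : ∀ i, l.2.fromHub i = none := by
      intro i
      by_contra h
      obtain ⟨M, hM⟩ := Option.ne_none_iff_exists'.1 h
      obtain ⟨p, hp, -⟩ := hl.begun_of_fromHub i M hM
      simp [hb] at hp
    rw [PMF.bind_map]
    set e := P.tableEquiv hC l.2.tA with he
    -- The same bijection, with the view as the first component.
    let e' : (Fin P.n → P.Segment) ≃ P.View × ((Fin P.m → F) × P.Hidden C) :=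
      e.trans ⟨fun x => (x.2.1, x.1, x.2.2), fun x => (x.2.1, x.1, x.2.2), fun _ => rfl,
        fun _ => rfl⟩
    rw [Params.posterior, Params.uniformTables, PMF.uniformOfFintype_resample_fst e', PMF.map_bind]
    refine congrArg (PMF.bind _) (funext fun v => ?_)
    rw [PMF.map_comp]
    change _ = P.uniformTables.map
      (P.recon hC (l.1, { l.2 with begun := some (l.2.tA, v) }))
    refine congrFun (congrArg PMF.map (funext fun w => ?_)) _
    simp only [Function.comp, Params.recon, Params.reconOf, Params.reconNet, Params.honestA, hst,
      if_true, hb, hfrom, Params.SimState.tablesA]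
    have h1 : e (e'.symm (v, (e' w.1).2)) = ((e w.1).1, v, (e w.1).2.2) := e.apply_symm_apply _
    rw [h1]
    rfl
  · rw [PMF.pure_bind]

end Views

end DSKE

/-! ### Bob's result -/

namespace DSKE

section Bob

variable {F : Type} [Field F] [Fintype F] {P : Params F} {C : Finset (Fin P.n)}

theorem Params.toOuterMeasure_keyA_le (i : Fin P.n) {V : Set (F × F)}
    (hV : V.ncard ≤ P.s * Fintype.card F)
    {bad : Set ((Fin P.n → P.Segment) × (Fin P.n → P.Segment))}
    (h : ∀ w ∈ bad, (w.1 i).2 ∈ V) : P.uniformTables.toOuterMeasure bad ≤ P.forgeProb := by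
  have hπ : P.uniformTables.map (fun w => (w.1 i).2) = PMF.uniformOfFintype (F × F) := by
    rw [← PMF.uniformOfFintype_map_snd (X := P.Vec) (Y := F × F),
      ← PMF.uniformOfFintype_map_eval (A := P.Segment) i,
      ← PMF.uniformOfFintype_map_fst (X := Fin P.n → P.Segment) (Y := Fin P.n → P.Segment),
      PMF.map_comp, PMF.map_comp]
    rfl
  rw [Params.forgeProb, ← mul_card_div_card_prod]
  exact PMF.toOuterMeasure_le_of_map_eq_uniform hπ h hV

theorem Params.toOuterMeasure_keyB_le (i : Fin P.n) {V : Set (F × F)}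
    (hV : V.ncard ≤ P.s * Fintype.card F)
    {bad : Set ((Fin P.n → P.Segment) × (Fin P.n → P.Segment))}
    (h : ∀ w ∈ bad, (w.2 i).2 ∈ V) : P.uniformTables.toOuterMeasure bad ≤ P.forgeProb := by
  have hπ : P.uniformTables.map (fun w => (w.2 i).2) = PMF.uniformOfFintype (F × F) := by
    rw [← PMF.uniformOfFintype_map_snd (X := P.Vec) (Y := F × F),
      ← PMF.uniformOfFintype_map_eval (A := P.Segment) i,
      ← PMF.uniformOfFintype_map_snd (X := Fin P.n → P.Segment) (Y := Fin P.n → P.Segment),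
      PMF.map_comp, PMF.map_comp]
    rfl
  rw [Params.forgeProb, ← mul_card_div_card_prod]
  exact PMF.toOuterMeasure_le_of_map_eq_uniform hπ h hV

theorem Params.toOuterMeasure_secret_le (hC : C.card < P.k) (t : Fin P.n → P.Segment)
    (S : Fin P.m → F) (o : F) {D : P.Vec} (hD : D ≠ 0) :
    P.uniformTables.toOuterMeasure {w | o = secretTag (ofSecretTag S o
      (P.tableEquiv hC t w.1).2.2.2.1.1 (P.tableEquiv hC t w.1).2.2.2.1.2 + D)} ≤
      P.secretForgeProb := by
  have := Fintype.ofFinite (LinearMap.ker (P.padMap ∘ₗ P.maskHonest C))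
  have hπ : P.uniformTables.map (fun w => (P.tableEquiv hC t w.1).2.2.2.1) =
      PMF.uniformOfFintype (F × F) := by
    rw [← PMF.uniformOfFintype_map_fst (X := F × F)
        (Y := LinearMap.ker (P.padMap ∘ₗ P.maskHonest C)),
      ← PMF.uniformOfFintype_map_snd (X := Fin P.n → F),
      ← PMF.uniformOfFintype_map_snd (X := P.View),
      ← PMF.uniformOfFintype_map_snd (X := Fin P.m → F),
      ← PMF.uniformOfFintype_map_equiv (P.tableEquiv hC t),
      ← PMF.uniformOfFintype_map_fst (X := Fin P.n → P.Segment) (Y := Fin P.n → P.Segment),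
      PMF.map_comp, PMF.map_comp, PMF.map_comp, PMF.map_comp, PMF.map_comp]
    rfl
  rw [Params.secretForgeProb, ← mul_card_div_card_prod]
  exact PMF.toOuterMeasure_le_of_map_eq_uniform hπ (fun w hw => hw)
    (ncard_secretTag_forge_le S o hD)

theorem Params.aliceSend_honestA {hC : C.card < P.k} {l : P.IdealState × P.SimState}
    (hl : P.Consistent l) {p : (Fin P.n → P.Segment) × P.View} (hp : l.2.begun = some p)
    (a : Fin P.n → P.Segment) (i : Fin P.n) :
    P.aliceSend (P.overlay C p.1 (P.honestA hC l a)) i = P.viewSend C p.1 p.2 i := by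
  rw [(P.isTableEquiv hC p.1).send_eq, Params.tableEquiv_honestA hl hp]

theorem Params.share_honestA {hC : C.card < P.k} {l : P.IdealState × P.SimState}
    (hl : P.Consistent l) {p : (Fin P.n → P.Segment) × P.View} (hp : l.2.begun = some p)
    (a : Fin P.n → P.Segment) (i : Fin P.n) :
    P.share (P.overlay C p.1 (P.honestA hC l a)) i =
      P.extend p.2.1 i + (P.overlay C p.1 (P.honestA hC l a) i).1 := by
  rw [(P.isTableEquiv hC p.1).share_eq, Params.tableEquiv_honestA hl hp]

theorem Params.aliceY₀_honestA {hC : C.card < P.k} {l : P.IdealState × P.SimState}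
    (hl : P.Consistent l) {p : (Fin P.n → P.Segment) × P.View} (hp : l.2.begun = some p)
    (a : Fin P.n → P.Segment) :
    P.aliceY₀ (P.overlay C p.1 (P.honestA hC l a)) =
      ofSecretTag l.1.S p.2.2.1 (P.tableEquiv hC p.1 a).2.2.2.1.1
        (P.tableEquiv hC p.1 a).2.2.2.1.2 := by
  rw [(P.isTableEquiv hC p.1).aliceY₀_eq, Params.tableEquiv_honestA hl hp]

/-- The first entry of a tag key is not affected by what has been observed, the second one is
determined by the tag. -/
theorem Params.honestA_key {hC : C.card < P.k} {l : P.IdealState × P.SimState}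
    (hl : P.Consistent l) {p : (Fin P.n → P.Segment) × P.View} (hp : l.2.begun = some p)
    (a : Fin P.n → P.Segment) (i : Fin P.n) :
    (P.honestA hC l a i).2 =
      ((a i).2.1, p.2.2.2 i - msgHash (a i).2.1 0 (P.viewMsg p.2 i).toList) := by
  have h1 : (P.honestA hC l a i).2.1 = (a i).2.1 := by
    rw [(P.isTableEquiv hC p.1).key_eq, (P.isTableEquiv hC p.1).key_eq,
      Params.tableEquiv_honestA hl hp]
  have h2 := (P.isTableEquiv hC p.1).tag_eq (P.honestA hC l a) i
  rw [Params.tableEquiv_honestA hl hp, h1] at h2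
  exact Prod.ext h1 h2

variable [DecidableEq F]

variable (C) in
/-- Bob would accept from the honest hub `i` a message that the hub has not sent. -/
def Params.BobForgery (hC : C.card < P.k) (l : P.IdealState × P.SimState) (i : Fin P.n) :
    Set ((Fin P.n → P.Segment) × (Fin P.n → P.Segment)) :=
  {w | i ∉ C ∧ ∃ M, P.first (l.2.atBob i) = some M ∧ l.2.fromHub i ≠ some M ∧
    P.validTag ((Params.reconNet C l (P.honestA hC l w.1) w.2).tB i) M}

variable (C) in
/-- The messages of the hubs in `T` lead to a wrong candidate that passes the secret validation. -/
def Params.SecretForgery (hC : C.card < P.k) (l : P.IdealState × P.SimState)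
    (T : Finset (Fin P.n)) : Set ((Fin P.n → P.Segment) × (Fin P.n → P.Segment)) :=
  {w | ∃ p, l.2.begun = some p ∧ P.interp T (l.2.deviation C p.1 p.2) (P.x 0) ≠ 0 ∧
    p.2.2.1 = secretTag (P.aliceY₀ (P.overlay C p.1 (P.honestA hC l w.1)) +
      P.interp T (l.2.deviation C p.1 p.2) (P.x 0))}

theorem Params.toOuterMeasure_bobForgery_le (hC : C.card < P.k) (l : P.IdealState × P.SimState)
    (i : Fin P.n) : P.uniformTables.toOuterMeasure (P.BobForgery C hC l i) ≤ P.forgeProb := by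
  rcases hM : P.first (l.2.atBob i) with _ | M
  · refine P.toOuterMeasure_keyB_le i (V := ∅) (by simp) ?_
    rintro w ⟨-, M, h, -⟩
    simp [hM] at h
  rcases hM' : l.2.fromHub i with _ | M'
  · refine P.toOuterMeasure_keyB_le i (P.ncard_fresh_le M) ?_
    rintro w ⟨hi, M₁, h, -, hv⟩
    obtain rfl : M = M₁ := by simpa [hM] using h
    rw [Params.reconNet_tB_of_notMem hi, hM'] at hv
    exact hv
  · by_cases hne : M' = M
    · refine P.toOuterMeasure_keyB_le i (V := ∅) (by simp) ?_
      rintro w ⟨-, M₁, h, h', -⟩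
      obtain rfl : M = M₁ := by simpa [hM] using h
      exact absurd (hM'.trans (congrArg some hne)) h'
    refine P.toOuterMeasure_keyB_le i (P.ncard_forge_le hne) ?_
    rintro w ⟨hi, M₁, h, -, hv⟩
    obtain rfl : M = M₁ := by simpa [hM] using h
    rw [Params.reconNet_tB_of_notMem hi, hM'] at hv
    exact hv

theorem Params.toOuterMeasure_secretForgery_le (hC : C.card < P.k)
    {l : P.IdealState × P.SimState} (hl : P.Consistent l) (T : Finset (Fin P.n)) :
    P.uniformTables.toOuterMeasure (P.SecretForgery C hC l T) ≤ P.secretForgeProb := by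
  rcases hp : l.2.begun with _ | p
  · have : P.SecretForgery C hC l T = ∅ := by
      ext w
      simp [Params.SecretForgery, hp]
    rw [this]
    simp
  by_cases hD : P.interp T (l.2.deviation C p.1 p.2) (P.x 0) = 0
  · have : P.SecretForgery C hC l T = ∅ := by
      rw [Set.eq_empty_iff_forall_notMem]
      rintro w ⟨p', hp', hne, -⟩
      obtain rfl : p = p' := by simpa [hp] using hp'
      exact hne hD
    rw [this]
    simp
  · refine le_trans (MeasureTheory.measure_mono ?_)
      (P.toOuterMeasure_secret_le hC p.1 l.1.S p.2.2.1 hD)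
    rintro w ⟨p', hp', -, h⟩
    obtain rfl : p = p' := by simpa [hp] using hp'
    rw [Params.aliceY₀_honestA hl hp] at h
    exact h

/-- Without forgeries of tags Bob accepts what the simulator assumes. -/
theorem Params.accepted_eq {hC : C.card < P.k} {l : P.IdealState × P.SimState}
    {w : (Fin P.n → P.Segment) × (Fin P.n → P.Segment)} {i : Fin P.n}
    (h : w ∉ P.BobForgery C hC l i) :
    P.accepted ((Params.reconNet C l (P.honestA hC l w.1) w.2).tB i) (l.2.atBob i) =
      l.2.accepted C i := by
  by_cases hi : i ∈ C
  · rw [Params.reconNet_tB_of_mem hi, Params.SimState.accepted, if_pos hi]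
  rw [Params.SimState.accepted, if_neg hi, Params.accepted]
  rcases hM : P.first (l.2.atBob i) with _ | M
  · rfl
  simp only
  by_cases hs : l.2.fromHub i = some M
  · rw [if_pos hs, if_pos]
    rw [Params.reconNet_tB_of_notMem hi, hs, Params.validTag, Params.tag, msgHash_eq_zero_add]
    simp [Params.honestB]
  · rw [if_neg hs, if_neg]
    exact fun hv => h ⟨hi, M, hM, hs, hv⟩

theorem Params.fromHub_of_accepted {s : P.SimState} {i : Fin P.n} {M : P.Message} (hi : i ∉ C)
    (h : s.accepted C i = some M) : ∃ T, s.fromHub i = some (M, T) := by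
  rw [Params.SimState.accepted, if_neg hi] at h
  rcases hM : P.first (s.atBob i) with _ | M'
  · simp [hM] at h
  · simp only [hM] at h
    split_ifs at h with hs
    refine ⟨M'.2, ?_⟩
    rw [hs, ← Option.some.inj h]

/-- What Bob decrypts is Alice's share plus the deviation that the simulator computes. -/
theorem Params.decrypt_eq {hC : C.card < P.k} {l : P.IdealState × P.SimState}
    (hl : P.Consistent l) {p} (hp : l.2.begun = some p)
    (w : (Fin P.n → P.Segment) × (Fin P.n → P.Segment)) {i : Fin P.n} {M : P.Message}
    (h : l.2.accepted C i = some M) :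
    P.decrypt ((Params.reconNet C l (P.honestA hC l w.1) w.2).tB i) M =
      P.share (P.overlay C p.1 (P.honestA hC l w.1)) i + l.2.deviation C p.1 p.2 i := by
  rw [Params.share_honestA hl hp, Params.SimState.deviation]
  by_cases hi : i ∈ C
  · rw [Params.reconNet_tB_of_mem hi, if_pos hi, h, Params.overlay, if_pos hi]
    simp
  · obtain ⟨T, hT⟩ := Params.fromHub_of_accepted hi h
    rw [Params.reconNet_tB_of_notMem hi, if_neg hi, hT, Params.overlay, if_neg hi, add_zero,
      Params.SimState.shareOf, hp]
    simp [Params.decrypt, Params.honestB]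

/-- Every candidate of Bob comes from shares with the deviations that the simulator computes. -/
theorem Params.mem_candidates_iff {hC : C.card < P.k} {l : P.IdealState × P.SimState}
    (hl : P.Consistent l) {w : (Fin P.n → P.Segment) × (Fin P.n → P.Segment)}
    (hw : ∀ i, w ∉ P.BobForgery C hC l i) (c : Candidate F P.m P.kidLen) :
    c ∈ P.candidates (Params.reconNet C l (P.honestA hC l w.1) w.2).tB l.2.atBob ↔
      ∃ p, l.2.begun = some p ∧ ∃ T : Finset (Fin P.n), T.card = P.k ∧
        (∀ i ∈ T, ∃ M, l.2.accepted C i = some M ∧ M.kid = P.kid ∧ M.o = p.2.2.1) ∧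
        c = ⟨P.kid, P.aliceY₀ (P.overlay C p.1 (P.honestA hC l w.1)) +
          P.interp T (l.2.deviation C p.1 p.2) (P.x 0), p.2.2.1⟩ := by
  have hY : ∀ p, l.2.begun = some p → ∀ T : Finset (Fin P.n), T.card = P.k →
      ∀ M : Fin P.n → P.Message, (∀ i ∈ T, l.2.accepted C i = some (M i)) →
      P.interp T (fun i => P.decrypt
        ((Params.reconNet C l (P.honestA hC l w.1) w.2).tB i) (M i)) (P.x 0) =
        P.aliceY₀ (P.overlay C p.1 (P.honestA hC l w.1)) +
          P.interp T (l.2.deviation C p.1 p.2) (P.x 0) := by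
    intro p hp T hT M hM
    rw [← P.interp_share _ hT, ← P.interp_add]
    exact P.interp_congr (fun i hi => Params.decrypt_eq hl hp w (hM i hi)) _
  constructor
  · rintro ⟨T, M, hT, hM, hc⟩
    simp only [Params.accepted_eq (hw _)] at hM
    -- More hubs are in `T` than are compromised, so some honest hub is among them.
    obtain ⟨i, hiT, hiC⟩ := Finset.exists_mem_notMem_of_card_lt_card (hT.symm ▸ hC)
    obtain ⟨T', hT'⟩ := Params.fromHub_of_accepted hiC (hM i hiT).1
    obtain ⟨p, hp, hkid, ho⟩ := hl.begun_of_fromHub i _ hT'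
    have hkid' : c.kid = P.kid := (hM i hiT).2.1.symm.trans hkid
    have ho' : c.o = p.2.2.1 := (hM i hiT).2.2.symm.trans ho
    refine ⟨p, hp, T, hT, fun j hj => ⟨M j, (hM j hj).1, ?_, ?_⟩, ?_⟩
    · rw [(hM j hj).2.1, hkid']
    · rw [(hM j hj).2.2, ho']
    · rw [hY p hp T hT M fun j hj => (hM j hj).1] at hc
      obtain ⟨ckid, cY, co⟩ := c
      simp only at hkid' ho' hc
      rw [hkid', ho', hc]
  · rintro ⟨p, hp, T, hT, hM, rfl⟩
    have : ∀ i, ∃ M, i ∈ T → l.2.accepted C i = some M ∧ M.kid = P.kid ∧ M.o = p.2.2.1 := by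
      intro i
      by_cases hi : i ∈ T
      · obtain ⟨M, h⟩ := hM i hi
        exact ⟨M, fun _ => h⟩
      · exact ⟨P.viewMsg p.2 i, fun h => absurd h hi⟩
    choose M hM using this
    refine ⟨T, M, hT, fun i hi => ?_, (hY p hp T hT M fun i hi => (hM i hi).1).symm⟩
    rw [Params.accepted_eq (hw _)]
    exact hM i hi

/-- Without forgeries Bob's result is that of the ideal resource. -/
theorem Params.bobResult_eq {hC : C.card < P.k} {l : P.IdealState × P.SimState}
    (hl : P.Consistent l) (hs : l.1.switch = l.2.good C) (hbob : l.1.bob = none)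
    {w : (Fin P.n → P.Segment) × (Fin P.n → P.Segment)}
    (hw : ∀ i, w ∉ P.BobForgery C hC l i)
    (hw' : ∀ T : Finset (Fin P.n), T.card = P.k → w ∉ P.SecretForgery C hC l T) :
    P.bobResult (Params.reconNet C l (P.honestA hC l w.1) w.2).tB l.2.atBob = P.idealBob l.1 := by
  have hval : ∀ c, c ∈ P.validated (Params.reconNet C l (P.honestA hC l w.1) w.2).tB l.2.atBob →
      l.2.Good C ∧ ∃ p, l.2.begun = some p ∧
        c = ⟨P.kid, P.aliceY₀ (P.overlay C p.1 (P.honestA hC l w.1)), p.2.2.1⟩ := by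
    rintro c ⟨hc, htag⟩
    obtain ⟨p, hp, T, hT, hM, rfl⟩ := (Params.mem_candidates_iff hl hw c).1 hc
    have hD : P.interp T (l.2.deviation C p.1 p.2) (P.x 0) = 0 := by
      by_contra hD
      exact hw' T hT ⟨p, hp, hD, htag⟩
    exact ⟨⟨p.1, p.2, hp, T, hT, hM, hD⟩, p, hp, by rw [hD, add_zero]⟩
  rw [Params.idealBob, hbob, hs, Params.SimState.good]
  by_cases hg : l.2.Good C
  · obtain ⟨t, v, hp, T, hT, hM, hD⟩ := id hg
    have hY := Params.aliceY₀_honestA (hC := hC) hl hp w.1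
    have hne : (P.validated (Params.reconNet C l (P.honestA hC l w.1) w.2).tB
        l.2.atBob).Nonempty := by
      refine ⟨⟨P.kid, P.aliceY₀ (P.overlay C t (P.honestA hC l w.1)), v.2.1⟩,
        (Params.mem_candidates_iff hl hw _).2 ⟨(t, v), hp, T, hT, hM, by rw [hD, add_zero]⟩, ?_⟩
      simp only
      rw [hY, secretTag_ofSecretTag]
    have hst : l.1.started = true := hl.started_of_begun (by simp [hp])
    rw [Params.bobResult, if_pos hne]
    obtain ⟨-, p, hp', hc⟩ := hval _ (P.pick_mem _ hne)
    obtain rfl : (t, v) = p := by simpa [hp] using hp'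
    rw [hc]
    simp only
    rw [hY, secret_ofSecretTag]
    simp [hst, hg]
  · rw [Params.bobResult, if_neg]
    · simp [hg]
    · rintro ⟨c, hc⟩
      exact hg (hval c hc).1

/-- When Bob ends the protocol, the real and the ideal system differ only by forgeries. -/
theorem Params.bisim_bob {hC : C.card < P.k} {l : P.IdealState × P.SimState}
    (hl : P.Consistent l) (hs : l.1.switch = l.2.good C) (hbob : l.1.bob = none) (q : Unit) :
    PMF.ApproxLE P.bobCost
      ((P.posterior hC l).bind fun s => (P.real C).step s ⟨.bob, q⟩)
      ((P.posterior hC ({ l.1 with bob := some (P.idealBob l.1) }, l.2)).map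
        (Prod.mk (P.idealBob l.1))) := by
  refine (Params.bind_step_approx (q := ⟨.bob, q⟩) (y := P.idealBob l.1)
    (f := fun w =>
      (P.bobResult (Params.reconNet C l (P.honestA hC l w.1) w.2).tB l.2.atBob,
        P.recon hC ({ l.1 with
          bob := some (P.bobResult (Params.reconNet C l (P.honestA hC l w.1) w.2).tB l.2.atBob) },
          l.2) w))
    ((⋃ T ∈ Finset.powersetCard P.k Finset.univ, P.SecretForgery C hC l T) ∪
      ⋃ i ∈ (Finset.univ : Finset (Fin P.n)), P.BobForgery C hC l i) ?_ ?_).mono ?_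
  · intro w
    rw [Params.recon, Params.reconOf, hbob]
    exact Params.real_step_bob_none _ _ _ _
  · intro w hw
    simp only [Set.mem_union, Set.mem_iUnion, not_or, not_exists, Finset.mem_powersetCard,
      Finset.subset_univ, true_and, Finset.mem_univ, exists_prop] at hw
    have h := Params.bobResult_eq hl hs hbob (fun i => hw.2 i) (fun T hT hT' => hw.1 T ⟨hT, hT'⟩)
    rw [h]
  · refine (MeasureTheory.measure_union_le _ _).trans (add_le_add ?_ ?_)
    · refine (MeasureTheory.measure_biUnion_finset_le _ _).trans ?_
      refine (Finset.sum_le_sum fun T _ => P.toOuterMeasure_secretForgery_le hC hl T).trans ?_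
      simp
    · refine (MeasureTheory.measure_biUnion_finset_le _ _).trans ?_
      refine (Finset.sum_le_sum fun i _ => P.toOuterMeasure_bobForgery_le hC l i).trans ?_
      simp

theorem Params.bisim_bob_done {hC : C.card < P.k} {l : P.IdealState × P.SimState}
    (r : Option P.Result) (hbob : l.1.bob = some r) (q : Unit) :
    ((P.posterior hC l).bind fun s => (P.real C).step s ⟨.bob, q⟩) =
      (P.posterior hC l).map (Prod.mk r) := by
  refine Params.bind_step_eq (q := ⟨.bob, q⟩) (y := r) fun w => ?_
  rw [Params.recon, Params.reconOf, hbob]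
  exact Params.real_step_bob_some _ _ _ _ _

end Bob

end DSKE

/-! ### Queries of Eve -/

namespace DSKE

section Eve

variable {F : Type} [Field F] [Fintype F] {P : Params F} {C : Finset (Fin P.n)}

variable (P) in
/-- The simulator knows whether Alice has started. -/
def Params.Noticed (l : P.IdealState × P.SimState) : Prop :=
  l.1.started = true → l.2.begun ≠ none

theorem Params.reconNet_fromAlice {hC : C.card < P.k} {l : P.IdealState × P.SimState}
    (hl : P.Consistent l) (hn : P.Noticed l) (a b : Fin P.n → P.Segment) (i : Fin P.n) :
    (Params.reconNet C l (P.honestA hC l a) b).fromAlice i = l.2.fromAlice C i := by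
  rcases hst : l.1.started with _ | _
  · have : l.2.begun = none := by
      by_contra h
      simp [hl.started_of_begun h] at hst
    simp [Params.reconNet, hst, Params.SimState.fromAlice, this]
  · obtain ⟨p, hp⟩ := Option.ne_none_iff_exists'.1 (hn hst)
    have h := Params.aliceSend_honestA (hC := hC) hl hp a i
    simp [Params.reconNet, hst, Params.SimState.fromAlice, hp, Params.SimState.tablesA, h]

variable [DecidableEq F]

open Classical in
variable (C) in
/-- The probability that the reaction to a query of Eve differs from the simulated one. -/
noncomputable def Params.SimState.cost (s : P.SimState) : (P.realEve C).Q → ENNReal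
  | .inl _ => 0
  | .inr i => if s.used i = false ∧ P.first (s.atHub i) ≠ none then P.forgeProb else 0

/-- The state of the real system after a change of the state of the simulator that does not concern
Alice's messages. -/
theorem Params.recon_congr {hC : C.card < P.k} {l : P.IdealState × P.SimState} {s : P.SimState}
    (hb : s.begun = l.2.begun) (ht : l.1.started = true → s.tablesA = l.2.tablesA)
    (hn : P.Noticed l) (hused : s.used = l.2.used)
    (w : (Fin P.n → P.Segment) × (Fin P.n → P.Segment)) :
    P.recon hC (l.1, s) w = P.realJoin C
      { tA := P.overlay C s.tA (P.honestA hC l w.1)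
        tB := P.overlay C s.tB fun i =>
          Params.honestB (s.fromHub i) (l.2.shareOf i (P.honestA hC l w.1 i)) (w.2 i)
        fromAlice := (Params.reconNet C l (P.honestA hC l w.1) w.2).fromAlice
        atHub := s.atHub
        fromHub := s.fromHub
        atBob := s.atBob }
      (if l.1.started then some (P.kid, l.1.S) else none) l.2.used l.1.bob := by
  have hA : P.honestA hC (l.1, s) w.1 = P.honestA hC l w.1 := by
    rcases hst : l.1.started with _ | _
    · simp [Params.honestA, hst]
    · obtain ⟨p, hp⟩ := Option.ne_none_iff_exists'.1 (hn hst)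
      simp [Params.honestA, hst, hb, hp]
  rw [Params.recon, Params.reconOf, hA, Params.reconNet, Params.reconNet, hused]
  congr 2
  · funext i
    simp only [Params.SimState.shareOf, hb]
  · funext i
    rcases hst : l.1.started with _ | _
    · simp
    · simp [ht hst]

theorem Params.bisim_hub_idle {hC : C.card < P.k} {l l' : P.IdealState × P.SimState}
    (i : {i : Fin P.n // i ∉ C})
    (h : ∀ w : (Fin P.n → P.Segment) × (Fin P.n → P.Segment), Params.reconOf C l' (P.honestA hC l' w.1) w.2 =
      P.realJoin C
        (Params.hubActivate (Params.reconNet C l (P.honestA hC l w.1) w.2) l.2.used i).1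
        (if l.1.started then some (P.kid, l.1.S) else none) (Function.update l.2.used i
          (Params.hubActivate (Params.reconNet C l (P.honestA hC l w.1) w.2) l.2.used i).2)
        l.1.bob) :
    ((P.posterior hC l).bind fun s => (P.real C).step s ⟨.eve, .inr i⟩) =
      (P.posterior hC l').map (Prod.mk ()) := by
  refine Params.bind_step_eq (q := ⟨.eve, .inr i⟩) (y := ()) fun w => ?_
  rw [Params.recon, Params.recon, h w]
  exact Params.real_step_hub _ _ _ _ _

/-- A hub rejects whatever differs from what Alice has sent to it, up to a forgery. -/
theorem Params.bisim_hub_reject {hC : C.card < P.k} {l : P.IdealState × P.SimState}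
    (hl : P.Consistent l) (hn : P.Noticed l) (i : {i : Fin P.n // i ∉ C})
    (hu : l.2.used i = false) {M : P.Tagged} (hM : P.first (l.2.atHub i) = some M)
    (hne : l.2.fromAlice C i ≠ some M) :
    PMF.ApproxLE P.forgeProb
      ((P.posterior hC l).bind fun s => (P.real C).step s ⟨.eve, .inr i⟩)
      ((P.posterior hC (l.1, { l.2 with used := Function.update l.2.used i true })).map
        (Prod.mk ())) := by
  refine (Params.bind_step_approx (q := ⟨.eve, .inr i⟩) (y := ())
    {w | P.validTag (P.honestA hC l w.1 i) M} (fun w => Params.real_step_hub _ _ _ _ _) ?_).mono ?_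
  · intro w hw
    have hA : (Params.reconNet C l (P.honestA hC l w.1) w.2).tA i = P.honestA hC l w.1 i := by
      simp [Params.reconNet, Params.overlay, i.2]
    have hact : Params.hubActivate (Params.reconNet C l (P.honestA hC l w.1) w.2) l.2.used i =
        (Params.reconNet C l (P.honestA hC l w.1) w.2, true) := by
      have hM' : P.first ((Params.reconNet C l (P.honestA hC l w.1) w.2).atHub i) = some M := hM
      rw [Params.hubActivate, hu, if_neg Bool.false_ne_true, hM']
      simp only [hA]
      exact if_neg hw
    rw [hact]
    rfl
  · rcases hp : l.2.begun with _ | p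
    · have hst : l.1.started = false := by
        by_contra h
        exact hn (by simpa using h) hp
      refine P.toOuterMeasure_keyA_le i (P.ncard_fresh_le M) fun w hw => ?_
      simp only [Params.honestA, hst, Bool.false_eq_true, if_false] at hw
      exact hw
    · have hne' : P.viewSend C p.1 p.2 i ≠ M := by
        intro h
        apply hne
        rw [Params.SimState.fromAlice, hp, Option.map_some, h]
      refine P.toOuterMeasure_keyA_le i (P.ncard_forge_le hne') fun w hw => ?_
      have hkey := Params.honestA_key (hC := hC) hl hp w.1 i
      simp only [Set.mem_ofPred_eq, Params.validTag, Params.tag, hkey] at hw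
      simpa [Params.viewSend, i.2] using hw

/-- The message of a hub to Bob is uniform, up to what it copies. -/
def Params.hubMsgEquiv (M : P.Message) (Y : P.Vec) : P.Segment ≃ (P.Vec × F) × F where
  toFun g := ((Y - g.1, P.tag g (P.simHubMsg M (Y - g.1))), g.2.1)
  invFun z := (Y - z.1.1, z.2, z.1.2 - msgHash z.2 0 (P.simHubMsg M z.1.1).toList)
  left_inv g := by
    refine Prod.ext (sub_sub_cancel _ _) (Prod.ext rfl ?_)
    simp only [Params.tag]
    rw [msgHash_eq_zero_add, add_sub_cancel_right]
  right_inv z := by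
    refine Prod.ext (Prod.ext (sub_sub_cancel _ _) ?_) rfl
    simp only [Params.tag, sub_sub_cancel]
    rw [msgHash_eq_zero_add, sub_add_cancel]

/-- A hub accepts what Alice has sent to it, and its message to Bob is hidden by Bob's segment. -/
theorem Params.bisim_hub_send {hC : C.card < P.k} {l : P.IdealState × P.SimState}
    (hl : P.Consistent l) (i : {i : Fin P.n // i ∉ C})
    (hu : l.2.used i = false) {M : P.Tagged} (hM : P.first (l.2.atHub i) = some M)
    (hA : l.2.fromAlice C i = some M) :
    ((P.posterior hC l).bind fun s => (P.real C).step s ⟨.eve, .inr i⟩) =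
      (PMF.uniformOfFintype (P.Vec × F)).bind fun z =>
        (P.posterior hC (l.1, { l.2 with
          fromHub := Function.update l.2.fromHub i (some (P.simHubMsg M.1 z.1, z.2))
          used := Function.update l.2.used i true })).map (Prod.mk ()) := by
  obtain ⟨p, hp, hv⟩ : ∃ p, l.2.begun = some p ∧ P.viewSend C p.1 p.2 i = M := by
    rcases hp : l.2.begun with _ | p
    · simp [Params.SimState.fromAlice, hp] at hA
    · exact ⟨p, rfl, by simpa [Params.SimState.fromAlice, hp] using hA⟩
  have hfrom := hl.used_of_fromHub i hu
  have hM1 : M.1 = P.viewMsg p.2 i := by rw [← hv, Params.viewSend]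
  have hshare : ∀ g : P.Segment, P.decrypt g M.1 = l.2.shareOf i g := by
    intro g
    rw [hM1, Params.SimState.shareOf, hp]
    rfl
  have hnetA : ∀ w : (Fin P.n → P.Segment) × (Fin P.n → P.Segment),
      (Params.reconNet C l (P.honestA hC l w.1) w.2).tA i = P.honestA hC l w.1 i := fun w => by
    simp [Params.reconNet, Params.overlay, i.2]
  have hnetB : ∀ w : (Fin P.n → P.Segment) × (Fin P.n → P.Segment),
      (Params.reconNet C l (P.honestA hC l w.1) w.2).tB i = w.2 i := fun w => by
    rw [Params.reconNet_tB_of_notMem i.2, hfrom]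
    rfl
  have hvalid : ∀ w : (Fin P.n → P.Segment) × (Fin P.n → P.Segment),
      P.validTag (P.honestA hC l w.1 i) M := by
    intro w
    have h := Params.aliceSend_honestA (hC := hC) hl hp w.1 i
    rw [hv, Params.aliceSend, Params.overlay, if_neg i.2] at h
    rw [← h]
    rfl
  -- The message that the hub sends, as a function of Bob's segment.
  have hsend : ∀ g g' : P.Segment, P.hubSend g g' M.1 =
      (P.simHubMsg M.1 (P.hubMsgEquiv M.1 (l.2.shareOf i g) g').1.1,
        (P.hubMsgEquiv M.1 (l.2.shareOf i g) g').1.2) := by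
    intro g g'
    have : P.hubMsg g g' M.1 = P.simHubMsg M.1 (l.2.shareOf i g - g'.1) := by
      rw [Params.hubMsg, hshare]
      rfl
    rw [Params.hubSend, this]
    rfl
  have hact : ∀ w : (Fin P.n → P.Segment) × (Fin P.n → P.Segment),
      Params.hubActivate (Params.reconNet C l (P.honestA hC l w.1) w.2) l.2.used i =
        ({ Params.reconNet C l (P.honestA hC l w.1) w.2 with
            fromHub := Function.update l.2.fromHub i
              (some (P.hubSend (P.honestA hC l w.1 i) (w.2 i) M.1)) }, true) := by
    intro w
    have hM' : P.first ((Params.reconNet C l (P.honestA hC l w.1) w.2).atHub i) = some M := hM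
    rw [Params.hubActivate, hu, if_neg Bool.false_ne_true, hM']
    simp only [hnetA, hnetB]
    exact if_pos (hvalid w)
  have hstep : ∀ w, (P.real C).step (P.recon hC l w) ⟨.eve, .inr i⟩ = PMF.pure ((),
      P.realJoin C { Params.reconNet C l (P.honestA hC l w.1) w.2 with
        fromHub := Function.update l.2.fromHub i
          (some (P.hubSend (P.honestA hC l w.1 i) (w.2 i) M.1)) }
        (if l.1.started then some (P.kid, l.1.S) else none) (Function.update l.2.used i true)
        l.1.bob) := by
    intro w
    have h := Params.real_step_hub (Params.reconNet C l (P.honestA hC l w.1) w.2)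
      (if l.1.started then some (P.kid, l.1.S) else none) l.2.used l.1.bob i
    rw [hact] at h
    exact h
  rw [Params.posterior, PMF.bind_map]
  refine (congrArg (PMF.bind _) (funext hstep)).trans ?_
  rw [Params.uniformTables, PMF.uniformOfFintype_resample_eval
    (fun a => P.hubMsgEquiv M.1 (l.2.shareOf i (P.honestA hC l a i))) i.1]
  refine (PMF.bind_bind _ _ _).trans ?_
  refine congrArg (PMF.bind _) (funext fun z => ?_)
  refine (PMF.bind_map _ _ _).trans ?_
  rw [Params.posterior, PMF.map_comp, ← PMF.bind_pure_comp]
  refine congrArg (PMF.bind _) (funext fun w => ?_)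
  have hA' : P.honestA hC (l.1, { l.2 with
      fromHub := Function.update l.2.fromHub i (some (P.simHubMsg M.1 z.1, z.2))
      used := Function.update l.2.used i true }) w.1 = P.honestA hC l w.1 := rfl
  simp only [Function.comp, hsend, Function.update_self, Equiv.apply_symm_apply, Params.recon,
    Params.reconOf, hA']
  refine congrArg (fun x => PMF.pure ((), x)) ?_
  simp only [Params.reconNet]
  congr 2
  refine congrArg (P.overlay C l.2.tB) (funext fun j => ?_)
  by_cases hj : j = i.1
  · subst hj
    rw [Function.update_self, Function.update_self, hfrom]
    rfl
  · rw [Function.update_of_ne hj, Function.update_of_ne hj]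
    rfl

theorem Params.bisim_react {hC : C.card < P.k} {l : P.IdealState × P.SimState}
    (hl : P.Consistent l) (hn : P.Noticed l) (q : (P.realEve C).Q) :
    PMF.ApproxLE (l.2.cost C q)
      ((P.posterior hC l).bind fun s => (P.real C).step s ⟨.eve, q⟩)
      ((l.2.react C q).bind fun r => (P.posterior hC (l.1, r.2)).map (Prod.mk r.1)) := by
  have hstep : ∀ (q : P.EveQuery C) (s : P.SimState) (y : (P.eveNet C).R q),
      s.begun = l.2.begun → (l.1.started = true → s.tablesA = l.2.tablesA) → s.used = l.2.used →
      (∀ w : (Fin P.n → P.Segment) × (Fin P.n → P.Segment),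
        P.netStep C (Params.reconNet C l (P.honestA hC l w.1) w.2) ⟨.eve, q⟩ =
        (y, { tA := P.overlay C s.tA (P.honestA hC l w.1)
              tB := P.overlay C s.tB fun i =>
                Params.honestB (s.fromHub i) (l.2.shareOf i (P.honestA hC l w.1 i)) (w.2 i)
              fromAlice := (Params.reconNet C l (P.honestA hC l w.1) w.2).fromAlice
              atHub := s.atHub
              fromHub := s.fromHub
              atBob := s.atBob })) →
      ((P.posterior hC l).bind fun s => (P.real C).step s ⟨.eve, .inl q⟩) =
        (P.posterior hC (l.1, s)).map (Prod.mk y) := by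
    intro q s y hb ht hused h
    refine Params.bind_step_eq (q := ⟨.eve, .inl q⟩) (y := y) fun w => ?_
    rw [Params.recon_congr hb ht hn hused]
    refine (Params.real_step_eve _ _ _ _ q).trans ?_
    rw [h w]
    rfl
  have htables : ∀ s : P.SimState, s.begun = l.2.begun →
      l.1.started = true → s.tablesA = l.2.tablesA := by
    intro s hb hst
    obtain ⟨p, hp⟩ := Option.ne_none_iff_exists'.1 (hn hst)
    simp [Params.SimState.tablesA, hb, hp]
  rcases q with q | i
  · refine PMF.ApproxLE.of_eq ?_
    cases q with
    | seeAlice i =>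
      refine Eq.trans ?_ (PMF.pure_bind _ _).symm
      refine hstep (.seeAlice i) l.2 _ rfl (fun _ => rfl) rfl fun w => ?_
      exact Prod.ext (Params.reconNet_fromAlice hl hn w.1 w.2 i) rfl
    | seeHub i =>
      refine Eq.trans ?_ (PMF.pure_bind _ _).symm
      exact hstep (.seeHub i) l.2 _ rfl (fun _ => rfl) rfl fun w => rfl
    | toHub i M =>
      refine Eq.trans ?_ (PMF.pure_bind _ _).symm
      exact hstep (.toHub i M) _ () rfl (htables _ rfl) rfl fun w => rfl
    | toBob i M =>
      refine Eq.trans ?_ (PMF.pure_bind _ _).symm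
      exact hstep (.toBob i M) _ () rfl (htables _ rfl) rfl fun w => rfl
    | setTableA i t =>
      refine Eq.trans ?_ (PMF.pure_bind _ _).symm
      refine hstep (.setTableA i t) _ () rfl (htables _ rfl) rfl fun w => ?_
      rw [P.overlay_update C i.2]
      rfl
    | setTableB i t =>
      refine Eq.trans ?_ (PMF.pure_bind _ _).symm
      refine hstep (.setTableB i t) _ () rfl (htables _ rfl) rfl fun w => ?_
      rw [P.overlay_update C i.2]
      rfl
  · rw [Params.SimState.react]
    split_ifs with hu
    · refine PMF.ApproxLE.of_eq (Eq.trans ?_ (PMF.pure_bind _ _).symm)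
      refine Params.bisim_hub_idle (l' := (l.1, l.2)) i fun w => ?_
      have hact : Params.hubActivate (Params.reconNet C l (P.honestA hC l w.1) w.2) l.2.used i =
        (Params.reconNet C l (P.honestA hC l w.1) w.2, true) := if_pos hu
      rw [hact, Function.update_eq_self_iff.2 hu.symm]
      rfl
    · have hu' : l.2.used i = false := by simpa using hu
      rcases hM : P.first (l.2.atHub i) with _ | M
      · refine PMF.ApproxLE.of_eq (Eq.trans ?_ (PMF.pure_bind _ _).symm)
        refine Params.bisim_hub_idle (l' := (l.1, l.2)) i fun w => ?_
        have hM' : P.first ((Params.reconNet C l (P.honestA hC l w.1) w.2).atHub i) = none := hM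
        have hact : Params.hubActivate (Params.reconNet C l (P.honestA hC l w.1) w.2) l.2.used i =
            (Params.reconNet C l (P.honestA hC l w.1) w.2, false) := by
          rw [Params.hubActivate, if_neg hu, hM']
        rw [hact, Function.update_eq_self_iff.2 hu'.symm]
        rfl
      · have hcost : l.2.cost C (.inr i) = P.forgeProb := by
          simp [Params.SimState.cost, hu', hM]
        rw [hcost]
        simp only
        split_ifs with hA
        · refine PMF.ApproxLE.of_eq (Eq.trans ?_ (PMF.bind_map _ _ _).symm)
          exact Params.bisim_hub_send hl i hu' hM hA
        · refine PMF.ApproxLE.trans_eq ?_ (PMF.pure_bind _ _).symm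
          exact Params.bisim_hub_reject hl hn i hu' hM hA

end Eve

end DSKE

/-! ### The security bound -/

namespace CC

theorem abs_toReal_sub_le {p q : PMF Bool} {c : ENNReal} (hc : c ≠ ⊤) (h : ∀ b, p b ≤ q b + c) :
    |(p true).toReal - (q true).toReal| ≤ c.toReal := by
  have key : ∀ b, (p b).toReal ≤ (q b).toReal + c.toReal := by
    intro b
    rw [← ENNReal.toReal_add (q.apply_ne_top b) hc]
    exact ENNReal.toReal_mono (ENNReal.add_ne_top.2 ⟨q.apply_ne_top b, hc⟩) (h b)
  have hsum : ∀ r : PMF Bool, (r true).toReal + (r false).toReal = 1 := by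
    intro r
    have h1 := r.tsum_coe
    rw [tsum_fintype, Fintype.sum_bool] at h1
    rw [← ENNReal.toReal_add (r.apply_ne_top _) (r.apply_ne_top _), h1, ENNReal.toReal_one]
  have h1 := key true
  have h2 := key false
  have h3 := hsum p
  have h4 := hsum q
  rw [abs_le]
  constructor <;> linarith

/-- A bound for the advantage of a distinguisher between a resource and a system that simulates
it approximately. -/
theorem Resource.abs_probTrue_sub_le {I : Interface} (R : Resource I) {SL : Type}
    (stepL : SL → (q : I.Q) → PMF (I.R q × SL)) (κ : SL → PMF R.State) (inv : SL → Prop)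
    (β : SL → ENNReal)
    (h : ∀ l, inv l → ∀ q, ∃ c,
      PMF.ApproxLE c ((κ l).bind fun s => R.step s q)
        ((stepL l q).bind fun r => (κ r.2).map (Prod.mk r.1)) ∧
      ∀ r ∈ (stepL l q).support, inv r.2 ∧ c + β r.2 ≤ β l)
    {l₀ : SL} (hinv : inv l₀) (hβ : β l₀ ≠ ⊤) (hstart : R.start = κ l₀) (D : Distinguisher I) :
    |R.probTrue D - (((D.run stepL l₀).map Prod.fst) true).toReal| ≤ (β l₀).toReal := by
  refine abs_toReal_sub_le hβ fun b => ?_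
  rw [hstart, PMF.map_bind]
  exact Prog.run_le_of_approx R.step stepL κ inv β h D b l₀ hinv

end CC

namespace DSKE

section Security

variable {F : Type} [Field F] [Fintype F] {P : Params F} {C : Finset (Fin P.n)}

theorem Params.notice_support {l : P.IdealState × P.SimState} (hl : P.Consistent l)
    {s : P.SimState} (hs : s ∈ (l.2.notice l.1.started).support) :
    P.Consistent (l.1, s) ∧ P.Noticed (l.1, s) ∧ s.used = l.2.used ∧ s.atHub = l.2.atHub := by
  rw [Params.SimState.notice] at hs
  split_ifs at hs with h
  · rw [PMF.mem_support_map_iff] at hs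
    obtain ⟨v, -, rfl⟩ := hs
    refine ⟨⟨fun _ => h.1, fun i M hM => ?_, hl.used_of_fromHub⟩, fun _ => by simp, rfl, rfl⟩
    obtain ⟨p, hp, -⟩ := hl.begun_of_fromHub i M hM
    simp [h.2] at hp
  · rw [PMF.support_pure, Set.mem_singleton_iff] at hs
    subst hs
    exact ⟨hl, fun hst hb => h ⟨hst, hb⟩, rfl, rfl⟩

variable [DecidableEq F]

variable (C) in
/-- The honest hubs that have not used their segments. -/
def Params.SimState.unused (s : P.SimState) : Finset (Fin P.n) :=
  Finset.univ.filter fun i => i ∉ C ∧ s.used i = false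

variable (C) in
/-- A bound for the probability of all forgeries that are still to come. -/
noncomputable def Params.budget (l : P.IdealState × P.SimState) : ENNReal :=
  (l.2.unused C).card * P.forgeProb +
    match l.1.bob with
    | none => P.bobCost
    | some _ => 0

/-- The reactions of the simulator preserve consistency; a hub that decides about a message pays for a
forgery and is not charged again. -/
theorem Params.react_support {l : P.IdealState × P.SimState} (hl : P.Consistent l)
    {q : (P.realEve C).Q} {r : (P.realEve C).R q × P.SimState}
    (hr : r ∈ (l.2.react C q).support) :
    P.Consistent (l.1, r.2) ∧
      l.2.cost C q + (r.2.unused C).card * P.forgeProb ≤ (l.2.unused C).card * P.forgeProb := by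
  rcases q with q | i
  · have h : r.2.begun = l.2.begun ∧ r.2.fromHub = l.2.fromHub ∧ r.2.used = l.2.used := by
      cases q <;>
      · replace hr := (PMF.mem_support_pure_iff _ _).1 hr
        subst hr
        exact ⟨rfl, rfl, rfl⟩
    refine ⟨⟨?_, ?_, ?_⟩, ?_⟩
    · simpa only [h.1] using hl.started_of_begun
    · simpa only [h.1, h.2.1] using hl.begun_of_fromHub
    · simpa only [h.2.2, h.2.1] using hl.used_of_fromHub
    · simp [Params.SimState.cost, Params.SimState.unused, h.2.2]
  · rw [Params.SimState.react] at hr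
    split_ifs at hr with hu
    · replace hr := (PMF.mem_support_pure_iff _ _).1 hr
      subst hr
      exact ⟨hl, by simp [Params.SimState.cost, hu]⟩
    have hu' : l.2.used i = false := by simpa using hu
    rcases hM : P.first (l.2.atHub i) with _ | M
    · simp only [hM] at hr
      replace hr := (PMF.mem_support_pure_iff _ _).1 hr
      subst hr
      exact ⟨hl, by simp [Params.SimState.cost, hM]⟩
    · simp only [hM] at hr
      have hcard : ∀ s : P.SimState, s.used = Function.update l.2.used i true →
          l.2.cost C (.inr i) + (s.unused C).card * P.forgeProb ≤
            (l.2.unused C).card * P.forgeProb := by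
        intro s hs
        have hmem : i.1 ∈ l.2.unused C := by simp [Params.SimState.unused, i.2, hu']
        have hs' : s.unused C = (l.2.unused C).erase i := by
          ext j
          by_cases hj : j = i.1
          · subst hj
            simp [Params.SimState.unused, hs]
          · simp [Params.SimState.unused, hs, hj]
        rw [hs', ← Finset.card_erase_add_one hmem]
        simp only [Params.SimState.cost, hu', hM]
        simp [add_mul, add_comm]
      have hused : ∀ s : P.SimState, s.used = Function.update l.2.used i true →
          (∀ j, j ≠ i.1 → s.fromHub j = l.2.fromHub j) →
          ∀ j, s.used j = false → s.fromHub j = none := by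
        intro s hs hf j hj
        by_cases hji : j = i.1
        · subst hji
          simp [hs] at hj
        · rw [hf j hji]
          rw [hs, Function.update_of_ne hji] at hj
          exact hl.used_of_fromHub j hj
      split_ifs at hr with hA
      · replace hr := (PMF.mem_support_map_iff _ _ _).1 hr
        obtain ⟨z, -, rfl⟩ := hr
        refine ⟨⟨hl.started_of_begun, fun j M' hM' => ?_,
          hused _ rfl fun j hj => Function.update_of_ne hj _ _⟩, hcard _ rfl⟩
        by_cases hj : j = i.1
        · subst hj
          obtain ⟨p, hp, hv⟩ := Option.map_eq_some_iff.1 hA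
          refine ⟨p, hp, ?_⟩
          have hM₁ : Function.update l.2.fromHub i.1 (some (P.simHubMsg M.1 z.1, z.2)) i.1 =
            some M' := hM'
          rw [Function.update_self] at hM₁
          obtain rfl := Option.some.inj hM₁
          rw [← hv]
          exact ⟨rfl, rfl⟩
        · exact hl.begun_of_fromHub j M' ((Function.update_of_ne hj _ _).symm.trans hM')
      · replace hr := (PMF.mem_support_pure_iff _ _).1 hr
        subst hr
        exact ⟨⟨hl.started_of_begun, hl.begun_of_fromHub, hused _ rfl fun _ _ => rfl⟩,
          hcard _ rfl⟩

/-- Every step of the real system is described by the lazy system, up to the probability of the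
forgeries that this step makes possible. -/
theorem Params.real_step_approx (hC : C.card < P.k) (l : P.IdealState × P.SimState)
    (hl : P.Consistent l ∧ l.1.switch = l.2.good C) (q : (P.outer C).Q) :
    ∃ c, PMF.ApproxLE c ((P.posterior hC l).bind fun s => (P.real C).step s q)
        ((P.lazyStep C l q).bind fun r => (P.posterior hC r.2).map (Prod.mk r.1)) ∧
      ∀ r ∈ (P.lazyStep C l q).support, (P.Consistent r.2 ∧ r.2.1.switch = r.2.2.good C) ∧
        c + Params.budget C r.2 ≤ Params.budget C l := by
  obtain ⟨hl, hs⟩ := hl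
  rcases q with ⟨_ | _ | _, q⟩
  · refine ⟨0, PMF.ApproxLE.of_eq ?_, ?_⟩
    · rcases hst : l.1.started with _ | _
      · rw [Params.lazyStep, if_neg (by simp [hst]), PMF.bind_map]
        exact Params.bisim_alice_start hl hst q
      · rw [Params.lazyStep, if_pos hst, PMF.pure_bind]
        exact Params.bisim_alice_started hst q
    · intro r hr
      rw [Params.lazyStep] at hr
      split_ifs at hr with hst
      · replace hr := (PMF.mem_support_pure_iff _ _).1 hr
        subst hr
        exact ⟨⟨hl, hs⟩, by rw [zero_add]⟩
      · replace hr := (PMF.mem_support_map_iff _ _ _).1 hr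
        obtain ⟨S, -, rfl⟩ := hr
        exact ⟨⟨⟨fun _ => rfl, hl.begun_of_fromHub, hl.used_of_fromHub⟩, hs⟩,
          by rw [zero_add]; exact le_rfl⟩
  · rcases hbob : l.1.bob with _ | res
    · refine ⟨P.bobCost, ?_, ?_⟩
      · refine PMF.ApproxLE.trans_eq ?_ (PMF.pure_bind _ _).symm
        exact Params.bisim_bob hl hs hbob q
      · intro r hr
        replace hr := (PMF.mem_support_pure_iff _ _).1 hr
        subst hr
        refine ⟨⟨⟨hl.started_of_begun, hl.begun_of_fromHub, hl.used_of_fromHub⟩, hs⟩, ?_⟩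
        simp only [Params.budget, hbob, add_zero]
        rw [add_comm]
    · have h : P.idealBob l.1 = res := by rw [Params.idealBob, hbob]
      have hl' : (({ l.1 with bob := some (P.idealBob l.1) }, l.2) :
          P.IdealState × P.SimState) = l := by
        rw [h, ← hbob]
      refine ⟨0, PMF.ApproxLE.of_eq (Eq.trans ?_ (PMF.pure_bind _ _).symm), ?_⟩
      · rw [h] at hl'
        simp only [h]
        exact (Params.bisim_bob_done res hbob q).trans
          (congrArg (fun x => (P.posterior hC x).map (Prod.mk res)) hl'.symm)
      · intro r hr
        replace hr := (PMF.mem_support_pure_iff _ _).1 hr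
        rw [hl'] at hr
        subst hr
        exact ⟨⟨hl, hs⟩, by rw [zero_add]⟩
  · have hcost : ∀ s ∈ (l.2.notice l.1.started).support, s.cost C q = l.2.cost C q := by
      intro s hs'
      obtain ⟨-, -, h1, h2⟩ := Params.notice_support hl hs'
      rcases q with q | i
      · rfl
      · simp only [Params.SimState.cost, h1, h2]
    refine ⟨l.2.cost C q, ?_, ?_⟩
    · rw [Params.bisim_notice (hC := hC) hl, PMF.bind_bind, Params.lazyStep, Params.simStep,
        PMF.bind_bind]
      refine PMF.ApproxLE.bind _ fun s hs' => ?_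
      obtain ⟨h1, h2, -⟩ := Params.notice_support hl hs'
      have h := Params.bisim_react (hC := hC) h1 h2 q
      rw [hcost s hs'] at h
      refine h.trans_eq (Eq.trans ?_ (PMF.bind_map _ _ _).symm)
      rfl
    · intro r hr
      rw [Params.lazyStep, Params.simStep, PMF.mem_support_bind_iff] at hr
      obtain ⟨s, hs', hr⟩ := hr
      replace hr := (PMF.mem_support_map_iff _ _ _).1 hr
      obtain ⟨r', hr', rfl⟩ := hr
      obtain ⟨h1, -, h2, -⟩ := Params.notice_support hl hs'
      obtain ⟨h3, h4⟩ := Params.react_support h1 hr'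
      refine ⟨⟨⟨h3.started_of_begun, h3.begun_of_fromHub, h3.used_of_fromHub⟩, rfl⟩, ?_⟩
      simp only [Params.budget]
      rw [← add_assoc]
      refine add_le_add_left ?_ _
      simp only [hcost s hs'] at h4
      refine h4.trans (le_of_eq ?_)
      simp only [Params.SimState.unused, h2]

variable (P) in
/-- The initial observations; the secret that is mentioned here is never used. -/
def Params.initial : P.IdealState × P.SimState := (⟨0, false, false, none⟩, P.simStart)

theorem Params.real_start (hC : C.card < P.k) : (P.real C).start = P.posterior hC P.initial := by
  change ((P.uniformTables.map (P.netStart C)).map _) = P.uniformTables.map _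
  refine (PMF.map_comp _ _ _).trans ?_
  refine congrFun (congrArg PMF.map (funext fun w => Prod.ext ?_ (funext fun p => ?_))) _
  · rfl
  · cases p <;> rfl

theorem Params.eager_start :
    (P.ideal.attach (simulate (P.simulator C))).start = P.eager C P.initial := by
  change (((PMF.uniformOfFintype (Fin P.m → F)).map _).map _) =
    (PMF.uniformOfFintype (Fin P.m → F)).map _
  refine (PMF.map_comp _ _ _).trans ?_
  refine congrFun (congrArg PMF.map (funext fun S => Prod.ext ?_ (funext fun p => ?_))) _
  · rfl
  · cases p <;> rfl

theorem Params.initial_consistent : P.Consistent P.initial ∧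
    P.initial.1.switch = P.initial.2.good C := by
  have hg : ¬ P.initial.2.Good C := by
    rintro ⟨t, v, h, -⟩
    simp [Params.initial, Params.simStart] at h
  have hs : P.initial.1.switch = false := rfl
  refine ⟨⟨fun h => absurd rfl h, fun i M h => absurd h (by simp [Params.initial,
    Params.simStart]), fun i _ => rfl⟩, ?_⟩
  rw [hs, Params.SimState.good]
  exact (decide_eq_false_iff_not.2 hg).symm

theorem Params.budget_initial_ne_top : Params.budget C P.initial ≠ ⊤ :=
  ENNReal.add_ne_top.2 ⟨ENNReal.mul_ne_top (by simp) P.forgeProb_ne_top, P.bobCost_ne_top⟩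

theorem Params.toReal_budget_initial_le : (Params.budget C P.initial).toReal ≤
    (P.n.choose P.k : ℝ) * (((P.m : ℝ) + 1) / (Fintype.card F : ℝ)) +
      2 * (P.n : ℝ) * ((P.s : ℝ) / (Fintype.card F : ℝ)) := by
  have h1 : P.forgeProb.toReal = (P.s : ℝ) / Fintype.card F := by
    simp [Params.forgeProb, ENNReal.toReal_div]
  have h2 : P.secretForgeProb.toReal = ((P.m : ℝ) + 1) / Fintype.card F := by
    rw [Params.secretForgeProb, ENNReal.toReal_div, ENNReal.toReal_natCast,
      ENNReal.toReal_natCast]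
    push_cast
    rfl
  have h3 : ((P.initial.2.unused C).card : ℝ) ≤ P.n := by
    have := (P.initial.2.unused C).card_le_univ
    rw [Fintype.card_fin] at this
    exact_mod_cast this
  have h4 : Params.budget C P.initial =
      (P.initial.2.unused C).card * P.forgeProb + P.bobCost := rfl
  rw [h4, Params.bobCost, ENNReal.toReal_add, ENNReal.toReal_add, ENNReal.toReal_mul,
    ENNReal.toReal_mul, ENNReal.toReal_mul, h1, h2, ENNReal.toReal_natCast,
    ENNReal.toReal_natCast, ENNReal.toReal_natCast]
  · have h5 : 0 ≤ (P.s : ℝ) / Fintype.card F := by positivity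
    nlinarith [mul_le_mul_of_nonneg_right h3 h5]
  · exact ENNReal.mul_ne_top (by simp) P.secretForgeProb_ne_top
  · exact ENNReal.mul_ne_top (by simp) P.forgeProb_ne_top
  · exact ENNReal.mul_ne_top (by simp) P.forgeProb_ne_top
  · exact P.bobCost_ne_top

theorem Params.advantage_le (hC : C.card < P.k) (D : Distinguisher (P.outer C)) :
    advantage (P.real C) (P.ideal.attach (simulate (P.simulator C))) D ≤
      (P.n.choose P.k : ℝ) * (((P.m : ℝ) + 1) / (Fintype.card F : ℝ)) +
        2 * (P.n : ℝ) * ((P.s : ℝ) / (Fintype.card F : ℝ)) := by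
  have h1 := (P.real C).abs_probTrue_sub_le (P.lazyStep C) (P.posterior hC)
    (fun l => P.Consistent l ∧ l.1.switch = l.2.good C) (Params.budget C)
    (Params.real_step_approx hC) (l₀ := P.initial) Params.initial_consistent
    Params.budget_initial_ne_top (Params.real_start hC) D
  have h2 := (P.ideal.attach (simulate (P.simulator C))).abs_probTrue_sub_le (P.lazyStep C)
    (P.eager C) (fun _ => True) (fun _ => 0)
    (fun l _ q => ⟨0, PMF.ApproxLE.of_eq (P.eager_step C l q), fun _ _ => ⟨trivial, by simp⟩⟩)
    (l₀ := P.initial) trivial (by simp) Params.eager_start D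
  rw [ENNReal.toReal_zero] at h2
  have h3 := sub_eq_zero.1 (abs_eq_zero.1 (le_antisymm h2 (abs_nonneg _)))
  rw [advantage, h3]
  exact h1.trans Params.toReal_budget_initial_le

end Security

end DSKE

theorem theorem1 {F : Type} [Field F] [Fintype F] [DecidableEq F] (P : DSKE.Params F) :
    P.IsSecure
      (min ((P.n.choose P.k : ℝ) * (((P.m : ℝ) + 1) / (Fintype.card F : ℝ))) 1
        + 2 * (P.n : ℝ) * min ((P.s : ℝ) / (Fintype.card F : ℝ)) 1) := by
  intro C hC
  refine ⟨P.simulator C, ?_⟩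
  have : Nonempty (Distinguisher (P.outer C)) := ⟨.ret true⟩
  refine ciSup_le fun D => ?_
  have h1 := advantage_le_one (P.real C) (P.ideal.attach (simulate (P.simulator C))) D
  have h2 := DSKE.Params.advantage_le hC D
  have hn : (1 : ℝ) ≤ P.n := by exact_mod_cast P.one_le_k.trans P.k_le_n
  have hs : 0 ≤ (P.s : ℝ) / Fintype.card F := by positivity
  have he : 0 ≤ (P.n.choose P.k : ℝ) * (((P.m : ℝ) + 1) / (Fintype.card F : ℝ)) := by positivity
  -- If one of the minima is `1`, the bound is at least `1`, as `1 ≤ n`.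
  rcases le_total ((P.n.choose P.k : ℝ) * (((P.m : ℝ) + 1) / (Fintype.card F : ℝ))) 1 with h3 | h3
  · rcases le_total ((P.s : ℝ) / (Fintype.card F : ℝ)) 1 with h4 | h4
    · rw [min_eq_left h3, min_eq_left h4]
      exact h2
    · rw [min_eq_left h3, min_eq_right h4]
      linarith
  · rw [min_eq_right h3]
    have : 0 ≤ 2 * (P.n : ℝ) * min ((P.s : ℝ) / (Fintype.card F : ℝ)) 1 := by positivity
    linarith
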